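/- Let $n\ge 2$ and let $\mu$ be a nonnegative locally finite Borel measure on $\mathbb R^n$. Here $C_0^\infty(\Omega)$ is the space of smooth functions with compact support contained in the open set $\Omega\subseteq\mathbb R^n$ (real-valued or complex-valued; the theorem holds in either case), $B_\delta(x_0)$ is the open Euclidean ball, $\|\cdot\|_{L^2}$ is the norm of $L^2(\mathbb R^n,dx)$, $|P|$ is the Lebesgue measure of $P$, and for compact $e\subset\mathbb R^n$ $$\mathrm{cap}(e)=\inf\Big\{\int_{\mathbb R^n}(|\nabla u|^2+|u|^2)\,dx:\ u\in C_0^\infty(\mathbb R^n)\ \text{real-valued},\ u(x)>1\ \text{on}\ e\Big\}.$$ The dyadic cubes are the half-open cubes $\prod_{i=1}^n[m_i2^{-k},(m_i+1)2^{-k})$ with $k\in\mathbb Z$, $m\in\mathbb Z^n$. Then the following statements are equivalent. (i) There exist $\epsilon_0>0$ and a function $C:(0,\epsilon_0)\to(0,\infty)$ such that for every $\epsilon\in(0,\epsilon_0)$ $$\int_{\mathbb R^n}|u|^2\,d\mu\le\epsilon\,\|\nabla u\|_{L^2}^2+C(\epsilon)\,\|u\|_{L^2}^2\qquad\text{for all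 } u\in C_0^\infty(\mathbb R^n).$$ (ii) $\displaystyle\lim_{\delta\to+0}\ \sup_{x_0\in\mathbb R^n}\ \sup\Big\{\int_{\mathbb R^n}|u|^2\,d\mu:\ u\in C_0^\infty(B_\delta(x_0)),\ \|\nabla u\|_{L^2}\le1\Big\}=0.$ (iii) $\displaystyle\lim_{\delta\to+0}\ \sup\Big\{\frac{\mu(e)}{\mathrm{cap}(e)}:\ e\subset\mathbb R^n\ \text{compact},\ \mathrm{cap}(e)>0,\ \operatorname{diam}(e)\le\delta\Big\}=0.$ (iv) $\displaystyle\lim_{\delta\to+0}\ \sup\Big\{\frac1{\mu(P_0)}\sum_{P\subseteq P_0}|P|^{\frac2n-1}\mu(P)^2:\ P_0\ \text{a dyadic cube},\ \operatorname{diam}(P_0)\le\delta,\ \mu(P_0)\ne0\Big\}=0,$ where the sum is over all dyadic cubes $P$ contained in $P_0$. The suprema and sums are taken in $[0,\infty]$, and the supremum of the empty set is $0$. -/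

import Mathlib

open MeasureTheory Filter Topology TopologicalSpace
open scoped ENNReal Distributions

namespace FormBound

/-- The squared norm `‖∇u‖²_{L²(ℝⁿ)} = ∫ ∑ᵢ |∂ᵢu(x)|² dx` of the gradient of a real or complex
function, as an extended nonnegative number. -/
noncomputable def gradSq {n : ℕ} {𝕜 : Type*} [RCLike 𝕜] (u : EuclideanSpace ℝ (Fin n) → 𝕜) :
    ℝ≥0∞ :=
  ∫⁻ x, ∑ i : Fin n, ‖fderiv ℝ u x (EuclideanSpace.single i (1 : ℝ))‖ₑ ^ 2

/-- The integral `∫ |u|² dμ`, as an extended nonnegative number. -/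
noncomputable def normSq {n : ℕ} {𝕜 : Type*} [RCLike 𝕜] (μ : Measure (EuclideanSpace ℝ (Fin n)))
    (u : EuclideanSpace ℝ (Fin n) → 𝕜) : ℝ≥0∞ :=
  ∫⁻ x, ‖u x‖ₑ ^ 2 ∂μ

/-- The open Euclidean ball, bundled as an open set. -/
def openBall {n : ℕ} (x₀ : EuclideanSpace ℝ (Fin n)) (δ : ℝ) :
    Opens (EuclideanSpace ℝ (Fin n)) :=
  ⟨Metric.ball x₀ δ, Metric.isOpen_ball⟩

/-- The capacity associated with the Sobolev space `W^{1,2}(ℝⁿ)` (used for compact sets `e`): the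
infimum of `∫ (|∇u|² + |u|²) dx` over real `u ∈ C₀^∞(ℝⁿ)` with `u > 1` on `e`. -/
noncomputable def cap {n : ℕ} (e : Set (EuclideanSpace ℝ (Fin n))) : ℝ≥0∞ :=
  ⨅ (u : 𝓓((⊤ : Opens (EuclideanSpace ℝ (Fin n))), ℝ)) (_ : ∀ x ∈ e, 1 < u x),
    gradSq u + normSq volume u

/-- The half-open dyadic cube `∏ᵢ [mᵢ 2⁻ᵏ, (mᵢ + 1) 2⁻ᵏ)` of side length `2⁻ᵏ`, where
`p = (k, m)` with `k ∈ ℤ` and `m ∈ ℤⁿ`. For `n ≥ 1` distinct indices give distinct cubes. -/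
def dyadicCube {n : ℕ} (p : ℤ × (Fin n → ℤ)) : Set (EuclideanSpace ℝ (Fin n)) :=
  {x | ∀ i, (p.2 i : ℝ) * (2 : ℝ) ^ (-p.1) ≤ x i ∧ x i < ((p.2 i : ℝ) + 1) * (2 : ℝ) ^ (-p.1)}

/-- The sum `∑_{P ⊆ P₀} |P|^{2/n - 1} μ(P)²` over all dyadic cubes `P` contained in the dyadic
cube `P₀` with index `p₀`; here `|P|` is the Lebesgue measure of `P`. -/
noncomputable def carlesonSum {n : ℕ} (μ : Measure (EuclideanSpace ℝ (Fin n)))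
    (p₀ : ℤ × (Fin n → ℤ)) : ℝ≥0∞ :=
  ∑' p : {p : ℤ × (Fin n → ℤ) // dyadicCube p ⊆ dyadicCube p₀},
    volume (dyadicCube p.1) ^ (2 / (n : ℝ) - 1) * μ (dyadicCube p.1) ^ 2

end FormBound

namespace FormBound

/-! The four conditions are linked by the cycle (i) → (iii) → (ii) → (iv) → (i); each arrow is a
quantitative estimate in which smallness at small scales is preserved.

(i) → (iii), `capacity_of_formBound`: a test function `u` for the capacity is truncated to `ψ ∘ u`,
supported in `{u > 1/2}`. If `u` has small energy, this set has small volume by Markov's inequality,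
so the Faber–Krahn inequality (`exists_faberKrahn_small`) absorbs the term `C(ε)‖·‖²` into the
Dirichlet integral. Test functions of large energy are harmless because points have zero capacity
when `n ≥ 2` (`exists_small_energy`), so every set of small diameter has a competitor of small
energy.

(iii) → (ii), `trace_of_capacity`: this is Maz'ya's capacitary strong type argument
(`normSq_le_of_measure_le`). The level sets of `|u|²` at the heights `4 ^ k` are tested with
truncations of `|u|²` whose gradients live on disjoint bands, so their weighted energies add up to a
multiple of `‖∇u‖²`.

(ii) → (iv), `carleson_of_trace`: the trace inequality is tested on a smooth version of the dyadic
potential `∑ |P|^(2/n-1) μ(P) 1_P`. Its Dirichlet integral is bounded by the Carleson sum itself, by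
a Wolff-type estimate (`lintegral_sq_tsum_measure_near_le`), so a quadratic inequality for the sum
can be divided by the sum.

(iv) → (i), `formBound_of_carleson`: on a small cube `u` is its average plus a telescoping series of
differences of averages, each controlled by `∫ |∇u|` over a dyadic cube. By duality the series is
paired with the potential of `|u| μ`, whose energy is bounded by the Wolff-type estimate and the
dyadic Carleson embedding (`carleson_embedding`). The average produces the lower order term. -/

/-- Euclidean space of dimension `n`. -/
abbrev Euc (n : ℕ) := EuclideanSpace ℝ (Fin n)

variable {n : ℕ}

/-! ### Integer powers of two as extended nonnegative numbers. -/

theorem two_zpow_ne_zero (k : ℤ) : (2 : ℝ≥0∞) ^ k ≠ 0 :=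
  (ENNReal.zpow_pos (by norm_num) (by norm_num) k).ne'

theorem two_zpow_ne_top (k : ℤ) : (2 : ℝ≥0∞) ^ k ≠ ⊤ :=
  ENNReal.zpow_ne_top (by norm_num) (by norm_num) k

theorem two_zpow_add (j k : ℤ) : (2 : ℝ≥0∞) ^ (j + k) = 2 ^ j * 2 ^ k :=
  ENNReal.zpow_add (by norm_num) (by norm_num) j k

theorem two_zpow_mul_natCast (k : ℤ) (m : ℕ) : (2 : ℝ≥0∞) ^ (k * (m : ℤ)) = (2 ^ k) ^ m := by
  induction m with
  | zero => simp
  | succ m ih => rw [pow_succ, ← ih, ← two_zpow_add]; congr 1; push_cast; ring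

theorem ofReal_two_zpow (k : ℤ) : ENNReal.ofReal ((2 : ℝ) ^ k) = (2 : ℝ≥0∞) ^ k := by
  obtain ⟨m, rfl | rfl⟩ := k.eq_nat_or_neg
  · rw [zpow_natCast, zpow_natCast, ENNReal.ofReal_pow (by norm_num)]; simp
  · rw [zpow_neg, ENNReal.zpow_neg, zpow_natCast, zpow_natCast,
      ENNReal.ofReal_inv_of_pos (by positivity), ENNReal.ofReal_pow (by norm_num)]; simp

theorem tsum_two_zpow_neg : ∑' d : ℕ, (2 : ℝ≥0∞) ^ (-(d : ℤ)) = 2 := by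
  have : ∀ d : ℕ, (2 : ℝ≥0∞) ^ (-(d : ℤ)) = (2⁻¹) ^ d := fun d => by
    rw [ENNReal.zpow_neg, zpow_natCast, ENNReal.inv_pow]
  simp_rw [this]
  rw [ENNReal.tsum_geometric, ENNReal.one_sub_inv_two, inv_inv]

/-! ### Geometry of the dyadic grid and of neighbourhoods of dyadic cubes. -/

/-- The index of the dyadic cube of side length `2⁻ᵏ` that contains `x`. -/
noncomputable def idx (k : ℤ) (x : Euc n) : Fin n → ℤ := fun i => ⌊x i * 2 ^ k⌋

theorem mem_dyadicCube_iff {p : ℤ × (Fin n → ℤ)} {x : Euc n} :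
    x ∈ dyadicCube p ↔ idx p.1 x = p.2 := by
  rw [funext_iff]
  refine forall_congr' fun i => ?_
  have h : (0 : ℝ) < 2 ^ p.1 := by positivity
  rw [idx, Int.floor_eq_iff, zpow_neg, ← div_eq_mul_inv, ← div_eq_mul_inv, div_le_iff₀ h,
    lt_div_iff₀ h]

theorem measurable_idx (k : ℤ) : Measurable (idx k : Euc n → Fin n → ℤ) := by
  refine measurable_pi_lambda _ fun i => Int.measurable_floor.comp ?_
  fun_prop

theorem measurableSet_dyadicCube (p : ℤ × (Fin n → ℤ)) : MeasurableSet (dyadicCube p) := by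
  have : dyadicCube p = idx p.1 ⁻¹' {p.2} := by ext x; exact mem_dyadicCube_iff
  rw [this]
  exact measurable_idx _ (measurableSet_singleton _)

/-- The nesting of the grids becomes integer arithmetic: coarsening a level is floor division by a
power of two. -/
theorem idx_eq_ediv {j k : ℤ} (h : j ≤ k) (x : Euc n) (i : Fin n) :
    idx j x i = idx k x i / ((2 ^ (k - j).toNat : ℕ) : ℤ) := by
  rw [idx, idx, ← Int.floor_div_natCast]
  congr 1
  have : (2 : ℝ) ^ k = 2 ^ j * 2 ^ (k - j).toNat := by
    rw [← zpow_natCast, ← zpow_add₀ (by norm_num)]; congr 1; omega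
  rw [this]; push_cast
  field_simp

/-- The union of the dyadic cubes of side length `2⁻ᵏ` at (index) distance at most `r` from the one
that contains `y`. -/
def near (r : ℕ) (k : ℤ) (y : Euc n) : Set (Euc n) := {x | ∀ i, |idx k x i - idx k y i| ≤ r}

theorem mem_near_comm {r : ℕ} {k : ℤ} {x y : Euc n} : x ∈ near r k y ↔ y ∈ near r k x := by
  simp [near, abs_sub_comm]

theorem near_trans {r s : ℕ} {k : ℤ} {x y z : Euc n} (h : x ∈ near r k y) (h' : y ∈ near s k z) :
    x ∈ near (r + s) k z := fun i => by
  have := abs_sub_le (idx k x i) (idx k y i) (idx k z i)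
  have := h i; have := h' i
  push_cast; linarith

/-- Floor division by `m ≥ 1` does not increase an integer distance bound, since `a ≤ b + r ≤ b + r
* m`. Hence the same radius `r` serves at every coarser level. -/
theorem near_mono {r : ℕ} {j k : ℤ} (hjk : j ≤ k) {x y : Euc n} (h : x ∈ near r k y) :
    x ∈ near r j y := fun i => by
  have h1 := h i
  rw [idx_eq_ediv hjk, idx_eq_ediv hjk y]
  set m : ℤ := ((2 ^ (k - j).toNat : ℕ) : ℤ)
  have hm : 1 ≤ m := by simp only [m]; exact_mod_cast Nat.one_le_two_pow
  have hr : (0 : ℤ) ≤ r := by positivity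
  have key : ∀ a b : ℤ, a ≤ b + r → a / m ≤ b / m + r := fun a b hab => by
    rw [← Int.add_mul_ediv_right _ _ (by omega : m ≠ 0)]
    exact Int.ediv_le_ediv (by omega) (by nlinarith)
  rw [abs_le] at h1 ⊢
  have := key (idx k x i) (idx k y i) (by linarith)
  have := key (idx k y i) (idx k x i) (by linarith)
  constructor <;> linarith

theorem mem_near_zero {k : ℤ} {x y : Euc n} : x ∈ near 0 k y ↔ idx k x = idx k y := by
  simp [near, funext_iff, sub_eq_zero]

theorem idx_eq_of_le {j k : ℤ} (h : j ≤ k) {x y : Euc n} (hxy : idx k x = idx k y) :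
    idx j x = idx j y :=
  mem_near_zero.1 (near_mono h (mem_near_zero.2 hxy))

theorem dyadicCube_subset_of_mem {p q : ℤ × (Fin n → ℤ)} (h : p.1 ≤ q.1) {x : Euc n}
    (hp : x ∈ dyadicCube p) (hq : x ∈ dyadicCube q) : dyadicCube q ⊆ dyadicCube p := fun y hy => by
  rw [mem_dyadicCube_iff] at *
  rw [← hp]
  exact idx_eq_of_le h (hy.trans hq.symm)

theorem near_zero_eq (k : ℤ) (y : Euc n) : near 0 k y = dyadicCube (k, idx k y) := by
  ext x; rw [mem_near_zero, mem_dyadicCube_iff]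

theorem near_zero_subset {p : ℤ × (Fin n → ℤ)} {k : ℤ} (h : p.1 ≤ k) {y : Euc n}
    (hy : y ∈ dyadicCube p) : near 0 k y ⊆ dyadicCube p := by
  rw [near_zero_eq]
  exact dyadicCube_subset_of_mem h hy (mem_dyadicCube_iff.2 rfl)

theorem measurableSet_near_prod (r : ℕ) (k : ℤ) :
    MeasurableSet {q : Euc n × Euc n | q.1 ∈ near r k q.2} := by
  have : {q : Euc n × Euc n | q.1 ∈ near r k q.2} =
      (fun q : Euc n × Euc n => (idx k q.1, idx k q.2)) ⁻¹'
        {m | ∀ i, |m.1 i - m.2 i| ≤ (r : ℤ)} := rfl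
  rw [this]
  exact (((measurable_idx k).comp measurable_fst).prodMk ((measurable_idx k).comp measurable_snd))
    (Set.to_countable _).measurableSet

theorem measurableSet_near (r : ℕ) (k : ℤ) (y : Euc n) : MeasurableSet (near r k y) :=
  measurable_idx k ((Set.to_countable {m : Fin n → ℤ | ∀ i, |m i - idx k y i| ≤ (r : ℤ)}).measurableSet)

theorem measurable_measure_near (ν : Measure (Euc n)) (r : ℕ) (k : ℤ) :
    Measurable fun x : Euc n => ν (near r k x) := by
  have : (fun x : Euc n => ν (near r k x)) =
      (fun m : Fin n → ℤ => ν {z | ∀ i, |idx k z i - m i| ≤ (r : ℤ)}) ∘ idx k := rfl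
  rw [this]
  exact (Measurable.of_discrete).comp (measurable_idx k)

theorem volume_coordBox (a b : Fin n → ℝ) :
    volume {x : Euc n | ∀ i, a i ≤ x i ∧ x i < b i} = ∏ i, ENNReal.ofReal (b i - a i) := by
  rw [← Real.volume_pi_Ico, ← (PiLp.volume_preserving_ofLp (Fin n)).measure_preimage
    (MeasurableSet.univ_pi fun i => measurableSet_Ico).nullMeasurableSet]
  congr 1
  ext x; simp [Set.mem_pi]

theorem volume_near (r : ℕ) (k : ℤ) (y : Euc n) :
    volume (near r k y) = (2 * r + 1) ^ n * 2 ^ (-k * n) := by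
  have h : (0 : ℝ) < 2 ^ k := by positivity
  have : near r k y = {x : Euc n | ∀ i, ((idx k y i - r : ℤ) : ℝ) * 2 ^ (-k) ≤ x i ∧
      x i < ((idx k y i + r + 1 : ℤ) : ℝ) * 2 ^ (-k)} := by
    ext x
    refine forall_congr' fun i => ?_
    rw [zpow_neg, ← div_eq_mul_inv, ← div_eq_mul_inv, div_le_iff₀ h, lt_div_iff₀ h, ← Int.le_floor,
      ← Int.floor_lt, abs_le]
    simp only [idx]
    omega
  rw [this, volume_coordBox]
  have : ∀ i, ENNReal.ofReal (((idx k y i + r + 1 : ℤ) : ℝ) * 2 ^ (-k) -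
      ((idx k y i - r : ℤ) : ℝ) * 2 ^ (-k)) = (2 * r + 1) * 2 ^ (-k) := fun i => by
    rw [← ofReal_two_zpow, ← sub_mul, ENNReal.ofReal_mul' (by positivity)]
    congr 1
    push_cast
    rw [show ((idx k y i : ℝ) + r + 1 - (idx k y i - r)) = ((2 * r + 1 : ℕ) : ℝ) by push_cast; ring,
      ENNReal.ofReal_natCast]
    push_cast; rfl
  simp_rw [this]
  rw [Finset.prod_const, Finset.card_univ, Fintype.card_fin, mul_pow, two_zpow_mul_natCast]

/-- The corner of the dyadic cube with index `p`. -/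
noncomputable def corner (p : ℤ × (Fin n → ℤ)) : Euc n :=
  WithLp.toLp 2 fun i => (p.2 i : ℝ) * 2 ^ (-p.1)

theorem corner_mem (p : ℤ × (Fin n → ℤ)) : corner p ∈ dyadicCube p := fun i => by
  have h : (0 : ℝ) < 2 ^ (-p.1) := by positivity
  simp only [corner]
  constructor <;> nlinarith

theorem volume_dyadicCube (p : ℤ × (Fin n → ℤ)) : volume (dyadicCube p) = 2 ^ (-p.1 * n) := by
  have := near_zero_eq p.1 (corner p)
  rw [mem_dyadicCube_iff.1 (corner_mem p)] at this
  rw [← this, volume_near]; simp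

/-- The weight of the Carleson sum depends only on the level and becomes an integer power, so that
exponents can later be added with `ring`. -/
theorem volume_dyadicCube_rpow (hn : n ≠ 0) (p : ℤ × (Fin n → ℤ)) :
    volume (dyadicCube p) ^ (2 / (n : ℝ) - 1) = 2 ^ (p.1 * (n - 2)) := by
  have hn' : (n : ℝ) ≠ 0 := by exact_mod_cast hn
  rw [volume_dyadicCube, ← ENNReal.rpow_intCast, ← ENNReal.rpow_mul, ← ENNReal.rpow_intCast]
  congr 1
  push_cast
  field_simp
  ring

theorem le_level_of_subset (hn : n ≠ 0) {p q : ℤ × (Fin n → ℤ)}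
    (h : dyadicCube p ⊆ dyadicCube q) : q.1 ≤ p.1 := by
  have h1 := measure_mono (μ := volume) h
  rw [volume_dyadicCube, volume_dyadicCube, ← ofReal_two_zpow, ← ofReal_two_zpow,
    ENNReal.ofReal_le_ofReal_iff (by positivity),
    zpow_le_zpow_iff_right₀ (by norm_num : (1 : ℝ) < 2)] at h1
  have : (0 : ℤ) < n := by exact_mod_cast Nat.pos_of_ne_zero hn
  nlinarith

theorem dist_le_of_mem_dyadicCube {p : ℤ × (Fin n → ℤ)} {x y : Euc n} (hx : x ∈ dyadicCube p)
    (hy : y ∈ dyadicCube p) : dist x y ≤ n * 2 ^ (-p.1) := by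
  have h0 : (0 : ℝ) ≤ 2 ^ (-p.1) := by positivity
  rw [EuclideanSpace.dist_eq]
  refine Real.sqrt_le_iff.2 ⟨by positivity, ?_⟩
  calc ∑ i, dist (x i) (y i) ^ 2 ≤ ∑ i : Fin n, ((2 : ℝ) ^ (-p.1)) ^ 2 := by
        refine Finset.sum_le_sum fun i _ => ?_
        have h1 := hx i; have h2 := hy i
        refine pow_le_pow_left₀ dist_nonneg ?_ 2
        rw [Real.dist_eq, abs_le]
        constructor <;> linarith
    _ = n * ((2 : ℝ) ^ (-p.1)) ^ 2 := by simp
    _ ≤ (n * 2 ^ (-p.1)) ^ 2 := by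
        rw [mul_pow]
        refine mul_le_mul_of_nonneg_right ?_ (by positivity)
        exact_mod_cast Nat.le_self_pow (by norm_num) n

theorem isBounded_dyadicCube (p : ℤ × (Fin n → ℤ)) : Bornology.IsBounded (dyadicCube p) :=
  Metric.isBounded_iff.2 ⟨_, fun _ hx _ hy => dist_le_of_mem_dyadicCube hx hy⟩

theorem diam_dyadicCube_le (p : ℤ × (Fin n → ℤ)) :
    Metric.diam (dyadicCube p) ≤ n * 2 ^ (-p.1) :=
  Metric.diam_le_of_forall_dist_le (by positivity) fun _ hx _ hy => dist_le_of_mem_dyadicCube hx hy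

theorem half_side_le_diam (hn : n ≠ 0) (p : ℤ × (Fin n → ℤ)) :
    2 ^ (-p.1) / 2 ≤ Metric.diam (dyadicCube p) := by
  have h : (0 : ℝ) < 2 ^ (-p.1) := by positivity
  set y : Euc n := WithLp.toLp 2 fun i => ((p.2 i : ℝ) + 1 / 2) * 2 ^ (-p.1) with hy
  have hy' : y ∈ dyadicCube p := fun i => by
    simp only [hy]
    constructor <;> nlinarith
  refine le_trans ?_ (Metric.dist_le_diam_of_mem (isBounded_dyadicCube p) hy' (corner_mem p))
  rw [EuclideanSpace.dist_eq]
  refine Real.le_sqrt_of_sq_le ?_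
  have : ∀ i : Fin n, dist (y i) (corner p i) ^ 2 = (2 ^ (-p.1) / 2) ^ 2 := fun i => by
    simp only [hy, corner, Real.dist_eq, sq_abs]; ring
  simp_rw [this]
  rw [Finset.sum_const, Finset.card_univ, Fintype.card_fin, nsmul_eq_mul]
  have : (1 : ℝ) ≤ n := by exact_mod_cast Nat.one_le_iff_ne_zero.2 hn
  nlinarith [sq_nonneg ((2 : ℝ) ^ (-p.1) / 2)]

/-! ### Energy of dyadic potentials (Wolff-type estimate). -/

/-- The square is a symmetric double sum, hence at most twice its part `i ≤ j`. It is indexed by the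
gap `d = j - i`, in which the estimates below decay geometrically. -/
theorem tsum_sq_le (a : ℕ → ℝ≥0∞) :
    (∑' j, a j) ^ 2 ≤ 2 * ∑' i, ∑' d, a i * a (i + d) := by
  have hshift : ∀ i, ∑' d, a i * a (i + d) = ∑' j, if i ≤ j then a i * a j else 0 := fun i => by
    have hinj : Function.Injective fun d : ℕ => i + d := fun x y h => by simpa using h
    rw [← hinj.tsum_eq (f := fun j => if i ≤ j then a i * a j else 0)]
    · simp
    · intro j hj
      have : i ≤ j := by by_contra h; simp [h] at hj
      exact ⟨j - i, by simp; omega⟩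
  simp_rw [hshift]
  rw [sq, ← ENNReal.tsum_mul_right, two_mul]
  simp_rw [← ENNReal.tsum_mul_left]
  calc ∑' i, ∑' j, a i * a j
      ≤ ∑' i, ∑' j, ((if i ≤ j then a i * a j else 0) + if j ≤ i then a j * a i else 0) := by
        refine ENNReal.tsum_le_tsum fun i => ENNReal.tsum_le_tsum fun j => ?_
        rcases le_total i j with h | h
        · simp [h]
        · simp [h, mul_comm]
    _ = _ := by
        simp_rw [ENNReal.tsum_add]
        congr 1
        exact ENNReal.tsum_comm

/-- Tonelli: the factor at the finer level `j` is opened as an integral over `y`. For fixed `y` the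
admissible `x` fill a set of volume `(2r+1)^n 2^(-jn)`, and for them the coarse neighbourhood of `x`
lies in the one of `y` with twice the radius. -/
theorem lintegral_measure_near_mul_le (ν : Measure (Euc n)) [SFinite ν] (r : ℕ) {i j : ℤ}
    (hij : i ≤ j) :
    ∫⁻ x, ν (near r i x) * ν (near r j x) ≤
      (2 * r + 1) ^ n * 2 ^ (-j * n) * ∫⁻ y, ν (near (2 * r) i y) ∂ν := by
  set S : Set (Euc n × Euc n) := {q | q.1 ∈ near r j q.2}
  have hS : MeasurableSet S := measurableSet_near_prod r j
  have h1 : ∀ x, ν (near r i x) * ν (near r j x) =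
      ∫⁻ y, ν (near r i x) * S.indicator 1 (y, x) ∂ν := fun x => by
    rw [lintegral_const_mul]
    · congr 1
      rw [← lintegral_indicator_one (measurableSet_near r j x)]; rfl
    · exact (measurable_one.indicator hS).comp measurable_prodMk_right
  simp_rw [h1]
  rw [lintegral_lintegral_swap]
  · rw [← lintegral_const_mul _ (measurable_measure_near ν _ _)]
    refine lintegral_mono fun y => ?_
    calc ∫⁻ x, ν (near r i x) * S.indicator 1 (y, x)
        ≤ ∫⁻ x, (near r j y).indicator (fun _ => ν (near (2 * r) i y)) x := by
          refine lintegral_mono fun x => ?_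
          by_cases hx : x ∈ near r j y
          · have hx' : (y, x) ∈ S := mem_near_comm.1 hx
            simp only [Set.indicator_of_mem hx, Set.indicator_of_mem hx', Pi.one_apply, mul_one]
            refine measure_mono fun z hz => ?_
            rw [two_mul]
            exact near_trans hz (near_mono hij hx)
          · have hx' : (y, x) ∉ S := fun h => hx (mem_near_comm.1 h)
            simp [Set.indicator_of_notMem hx']
      _ = _ := by
          rw [lintegral_indicator_const (measurableSet_near _ _ _), volume_near, mul_comm]
  · exact (((measurable_measure_near ν r i).comp measurable_fst).mul
      ((measurable_one.indicator hS).comp measurable_swap)).aemeasurable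

/-- The levels are almost orthogonal: the weights of the levels `i` and `i + d`, times the volume of
the finer cube, equal `2^(-d)` times the diagonal weight at level `i`, and the sum over `d` is 2.
The factor `θ` allows the series to be truncated. -/
theorem lintegral_sq_tsum_measure_near_le (ν : Measure (Euc n)) [SFinite ν] (r : ℕ) (k₀ : ℤ)
    (θ : ℕ → ℝ≥0∞) (hθ : ∀ j, θ j ≤ 1) :
    ∫⁻ x, (∑' j : ℕ, θ j * (2 ^ ((k₀ + j) * ((n : ℤ) - 1)) * ν (near r (k₀ + j) x))) ^ 2 ≤
      4 * (2 * r + 1) ^ n * ∑' j : ℕ, θ j * (2 ^ ((k₀ + j) * ((n : ℤ) - 2)) *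
        ∫⁻ y, ν (near (2 * r) (k₀ + j) y) ∂ν) := by
  set w : ℕ → ℝ≥0∞ := fun j => 2 ^ ((k₀ + j) * ((n : ℤ) - 1)) with hw
  set M : ℕ → ℝ≥0∞ := fun j => ∫⁻ y, ν (near (2 * r) (k₀ + j) y) ∂ν with hM
  set f : ℕ → Euc n → ℝ≥0∞ := fun j x => θ j * (w j * ν (near r (k₀ + j) x)) with hf
  have hm : ∀ j : ℕ, Measurable (f j) := fun j =>
    ((measurable_measure_near ν r _).const_mul _).const_mul _
  have hpair : ∀ i d : ℕ, ∫⁻ x, f i x * f (i + d) x ≤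
        (2 * r + 1) ^ n * 2 ^ (-(d : ℤ)) * (θ i * (2 ^ ((k₀ + i) * ((n : ℤ) - 2)) * M i)) :=
      fun i d => by
    calc _ = ∫⁻ x, (θ i * θ (i + d) * (w i * w (i + d))) *
          (ν (near r (k₀ + i) x) * ν (near r (k₀ + (i + d : ℕ)) x)) :=
          lintegral_congr fun x => by simp only [hf]; ring
      _ = (θ i * θ (i + d) * (w i * w (i + d))) *
            ∫⁻ x, ν (near r (k₀ + i) x) * ν (near r (k₀ + (i + d : ℕ)) x) :=
          lintegral_const_mul _ ((measurable_measure_near ν r _).mul (measurable_measure_near ν r _))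
      _ ≤ (θ i * 1 * (w i * w (i + d))) *
            ((2 * r + 1) ^ n * 2 ^ (-(k₀ + (i + d : ℕ)) * n) * M i) := by
          gcongr
          · exact hθ _
          · exact lintegral_measure_near_mul_le ν r (by push_cast; omega)
      _ = (2 * r + 1) ^ n * θ i * (w i * w (i + d) * 2 ^ (-(k₀ + (i + d : ℕ)) * (n : ℤ))) * M i := by
          ring
      _ = (2 * r + 1) ^ n * θ i * (2 ^ (-(d : ℤ)) * 2 ^ ((k₀ + i) * ((n : ℤ) - 2))) * M i := by
          congr 2
          simp only [hw]
          rw [← two_zpow_add, ← two_zpow_add, ← two_zpow_add]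
          congr 1; push_cast; ring
      _ = _ := by ring
  calc _ ≤ ∫⁻ x, 2 * ∑' i : ℕ, ∑' d : ℕ, f i x * f (i + d) x :=
        lintegral_mono fun x => tsum_sq_le fun j : ℕ => f j x
    _ = 2 * ∑' i : ℕ, ∑' d : ℕ, ∫⁻ x, f i x * f (i + d) x := by
        rw [lintegral_const_mul, lintegral_tsum]
        · congr 2; funext i
          rw [lintegral_tsum]
          exact fun d => ((hm i).mul (hm (i + d))).aemeasurable
        · exact fun i => (Measurable.tsum fun d => (hm i).mul (hm (i + d))).aemeasurable
        · exact Measurable.tsum fun i => Measurable.tsum fun d => (hm i).mul (hm (i + d))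
    _ ≤ 2 * ∑' i : ℕ, ∑' d : ℕ, (2 * r + 1) ^ n * 2 ^ (-(d : ℤ)) *
          (θ i * (2 ^ ((k₀ + i) * ((n : ℤ) - 2)) * M i)) := by
        gcongr with i d
        exact hpair i d
    _ = _ := by
        simp_rw [ENNReal.tsum_mul_right, ENNReal.tsum_mul_left, tsum_two_zpow_neg]
        ring

theorem lintegral_comp_idx (ν : Measure (Euc n)) (k : ℤ) (f : (Fin n → ℤ) → ℝ≥0∞) :
    ∫⁻ y, f (idx k y) ∂ν = ∑' m, f m * ν (dyadicCube (k, m)) := by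
  rw [← lintegral_map (f := f) Measurable.of_discrete (measurable_idx k), lintegral_countable']
  congr 1; funext m
  rw [Measure.map_apply (measurable_idx k) (measurableSet_singleton m)]
  congr 2
  ext x; exact (mem_dyadicCube_iff (p := (k, m))).symm

theorem lintegral_measure_near_zero (ν : Measure (Euc n)) (k : ℤ) :
    ∫⁻ y, ν (near 0 k y) ∂ν = ∑' m, ν (dyadicCube (k, m)) ^ 2 := by
  simp_rw [near_zero_eq]
  rw [lintegral_comp_idx ν k fun m => ν (dyadicCube (k, m))]
  simp_rw [sq]

/-- Neighbouring cubes cost only a constant: the integral is a sum of products `v (m + s) * v m`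
over `(2R+1)^n` shifts `s`, each product is at most the sum of the two squares, and the sum over `m`
is invariant under shifts. -/
theorem lintegral_measure_near_le (ν : Measure (Euc n)) (R : ℕ) (k : ℤ) :
    ∫⁻ y, ν (near R k y) ∂ν ≤ 2 * (2 * R + 1) ^ n * ∫⁻ y, ν (near 0 k y) ∂ν := by
  set v : (Fin n → ℤ) → ℝ≥0∞ := fun m => ν (dyadicCube (k, m)) with hv
  set B : Finset (Fin n → ℤ) := Fintype.piFinset fun _ => Finset.Icc (-(R : ℤ)) R with hB
  have hcard : (B.card : ℝ≥0∞) = (2 * R + 1) ^ n := by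
    rw [hB, Fintype.card_piFinset]
    simp only [Int.card_Icc, Finset.prod_const, Finset.card_univ, Fintype.card_fin]
    rw [show ((R : ℤ) + 1 - -(R : ℤ)).toNat = 2 * R + 1 by omega]
    push_cast; rfl
  have h1 : ∀ y, ν (near R k y) ≤ ∑ s ∈ B, v (idx k y + s) := fun y => by
    have : near R k y ⊆ ⋃ s ∈ B, dyadicCube (k, idx k y + s) := fun x hx => by
      simp only [Set.mem_iUnion]
      refine ⟨idx k x - idx k y, ?_, ?_⟩
      · simp only [hB, Fintype.mem_piFinset, Finset.mem_Icc, Pi.sub_apply]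
        exact fun i => abs_le.1 (hx i)
      · rw [mem_dyadicCube_iff]; simp
    exact (measure_mono this).trans (measure_biUnion_finset_le _ _)
  rw [lintegral_measure_near_zero]
  calc ∫⁻ y, ν (near R k y) ∂ν ≤ ∫⁻ y, ∑ s ∈ B, v (idx k y + s) ∂ν := lintegral_mono h1
    _ = ∑' m, (∑ s ∈ B, v (m + s)) * v m := lintegral_comp_idx ν k fun m => ∑ s ∈ B, v (m + s)
    _ ≤ ∑' m, ∑ s ∈ B, (v (m + s) ^ 2 + v m ^ 2) := by
        gcongr with m
        rw [Finset.sum_mul]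
        gcongr with s
        rcases le_total (v (m + s)) (v m) with h | h
        · exact le_add_left (by rw [sq]; gcongr)
        · exact le_add_right (by rw [sq]; gcongr)
    _ = ∑ s ∈ B, (∑' m, v (m + s) ^ 2 + ∑' m, v m ^ 2) := by
        rw [Summable.tsum_finsetSum fun _ _ => ENNReal.summable]
        simp_rw [ENNReal.tsum_add]
    _ = ∑ s ∈ B, (∑' m, v m ^ 2 + ∑' m, v m ^ 2) := by
        refine Finset.sum_congr rfl fun s _ => ?_
        rw [← (Equiv.addRight s).tsum_eq fun m => v m ^ 2]; rfl
    _ = _ := by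
        rw [Finset.sum_const, nsmul_eq_mul, hcard]; ring

/-- The Carleson sum is grouped by generations below `p₀` and becomes an energy. Restricting `ν` to
the cube removes the cubes of these generations that lie outside it, because dyadic cubes are nested
or disjoint. -/
theorem tsum_level_sq (hn : n ≠ 0) (ν : Measure (Euc n)) (p₀ : ℤ × (Fin n → ℤ)) :
    ∑' p : {p : ℤ × (Fin n → ℤ) // dyadicCube p ⊆ dyadicCube p₀},
      volume (dyadicCube p.1) ^ (2 / (n : ℝ) - 1) * ν (dyadicCube p.1) ^ 2 =
    ∑' j : ℕ, 2 ^ ((p₀.1 + j) * ((n : ℤ) - 2)) *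
      ∫⁻ y, ν.restrict (dyadicCube p₀) (near 0 (p₀.1 + j) y) ∂(ν.restrict (dyadicCube p₀)) := by
  simp_rw [volume_dyadicCube_rpow hn, lintegral_measure_near_zero, ← ENNReal.tsum_mul_left]
  rw [← ENNReal.tsum_prod (f := fun (j : ℕ) (m : Fin n → ℤ) => (2 : ℝ≥0∞) ^ ((p₀.1 + j) *
    ((n : ℤ) - 2)) * ν.restrict (dyadicCube p₀) (dyadicCube (p₀.1 + j, m)) ^ 2)]
  have hlev : ∀ p : {p : ℤ × (Fin n → ℤ) // dyadicCube p ⊆ dyadicCube p₀},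
      p₀.1 + ((p.1.1 - p₀.1).toNat : ℤ) = p.1.1 := fun p => by
    have := le_level_of_subset hn p.2; omega
  set i : {p : ℤ × (Fin n → ℤ) // dyadicCube p ⊆ dyadicCube p₀} → ℕ × (Fin n → ℤ) :=
    fun p => ((p.1.1 - p₀.1).toNat, p.1.2) with hi
  have hinj : Function.Injective i := fun p q h => by
    simp only [hi, Prod.mk.injEq] at h
    have h1 := hlev p; have h2 := hlev q
    exact Subtype.ext (Prod.ext (by omega) h.2)
  rw [← hinj.tsum_eq]
  · congr 1; funext p
    simp only [hi, hlev]
    rw [Measure.restrict_apply (measurableSet_dyadicCube _), Set.inter_eq_left.2 p.2]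
  · rintro ⟨j, m⟩ hjm
    have hne : (dyadicCube (p₀.1 + j, m) ∩ dyadicCube p₀).Nonempty := by
      by_contra h
      rw [Set.not_nonempty_iff_eq_empty] at h
      simp [Measure.restrict_apply (measurableSet_dyadicCube _), h] at hjm
    obtain ⟨x, hx, hx'⟩ := hne
    exact ⟨⟨(p₀.1 + j, m), dyadicCube_subset_of_mem (by simp) hx' hx⟩, by simp [hi]⟩

/-! ### The dyadic Carleson embedding theorem. -/

theorem eq_of_subset_of_level_eq {p q : ℤ × (Fin n → ℤ)} (h : dyadicCube p ⊆ dyadicCube q)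
    (hl : p.1 = q.1) : p = q := by
  have h1 := mem_dyadicCube_iff.1 (corner_mem p)
  have h2 := mem_dyadicCube_iff.1 (h (corner_mem p))
  rw [hl] at h1
  exact Prod.ext hl (h1.symm.trans h2)

/-- Passing to a strictly larger cube lowers the level, which is bounded below by that of `p₀`, so
the ascent stops. -/
theorem exists_maximal_dyadicCube (hn : n ≠ 0) {p₀ : ℤ × (Fin n → ℤ)} {E : Set (ℤ × (Fin n → ℤ))}
    (hE : ∀ p ∈ E, dyadicCube p ⊆ dyadicCube p₀) {p : ℤ × (Fin n → ℤ)} (hp : p ∈ E) :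
    ∃ q ∈ E, (∀ q' ∈ E, dyadicCube q ⊆ dyadicCube q' → q' = q) ∧ dyadicCube p ⊆ dyadicCube q := by
  induction hm : (p.1 - p₀.1).toNat using Nat.strong_induction_on generalizing p with
  | _ m ih =>
    by_cases hmax : ∀ q' ∈ E, dyadicCube p ⊆ dyadicCube q' → q' = p
    · exact ⟨p, hp, hmax, subset_rfl⟩
    · push Not at hmax
      obtain ⟨q, hq, hpq, hne⟩ := hmax
      have h1 := le_level_of_subset hn hpq
      have h2 := le_level_of_subset hn (hE q hq)
      have h3 : q.1 ≠ p.1 := fun h => hne (eq_of_subset_of_level_eq hpq h.symm).symm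
      obtain ⟨q', hq', hmax', hsub⟩ := ih (q.1 - p₀.1).toNat (by omega) hq rfl
      exact ⟨q', hq', hmax', hpq.trans hsub⟩

/-- The weak type estimate behind the dyadic Carleson embedding theorem. -/
theorem carleson_weak_type (hn : n ≠ 0) (μ : Measure (Euc n)) (p₀ : ℤ × (Fin n → ℤ))
    (α : ℤ × (Fin n → ℤ) → ℝ≥0∞) (A : ℝ≥0∞)
    (hA : ∀ q, dyadicCube q ⊆ dyadicCube p₀ →
      ∑' p : {p | dyadicCube p ⊆ dyadicCube q}, α p ≤ A * μ (dyadicCube q))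
    (h : Euc n → ℝ≥0∞) (t : ℝ≥0∞) (E : Set (ℤ × (Fin n → ℤ)))
    (hE : ∀ p ∈ E, dyadicCube p ⊆ dyadicCube p₀)
    (hE' : ∀ p ∈ E, t * μ (dyadicCube p) ≤ ∫⁻ x in dyadicCube p, h x ∂μ) :
    (∑' p : E, α p) * t ≤ A * ∫⁻ x in dyadicCube p₀, h x ∂μ := by
  -- The maximal cubes of `E` are disjoint and every cube of `E` lies in one of them. The packing
  -- condition is applied inside each, and the integrals of `h` over them add up.
  set Mx : Set (ℤ × (Fin n → ℤ)) :=
    {q | q ∈ E ∧ ∀ q' ∈ E, dyadicCube q ⊆ dyadicCube q' → q' = q} with hMx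
  have hcover : E ⊆ ⋃ q ∈ Mx, {p | dyadicCube p ⊆ dyadicCube q} := fun p hp => by
    obtain ⟨q, hq, hmax, hpq⟩ := exists_maximal_dyadicCube hn hE hp
    simp only [Set.mem_iUnion]
    exact ⟨q, ⟨hq, hmax⟩, hpq⟩
  have hdisj : Mx.PairwiseDisjoint dyadicCube := fun q hq q' hq' hne => by
    rw [Function.onFun, Set.disjoint_left]
    intro x hx hx'
    rcases le_total q.1 q'.1 with hl | hl
    · exact hne (hq'.2 q hq.1 (dyadicCube_subset_of_mem hl hx hx'))
    · exact hne (hq.2 q' hq'.1 (dyadicCube_subset_of_mem hl hx' hx)).symm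
  have h1 : ∑' p : E, α p ≤ A * ∑' q : Mx, μ (dyadicCube q.1) := by
    rw [← ENNReal.tsum_mul_left]
    exact ((ENNReal.tsum_mono_subtype α hcover).trans (ENNReal.tsum_biUnion_le_tsum _ _ _)).trans
      (ENNReal.tsum_le_tsum fun q => hA q.1 (hE q.1 q.2.1))
  have h2 : (∑' q : Mx, μ (dyadicCube q.1)) * t ≤ ∫⁻ x in dyadicCube p₀, h x ∂μ := by
    rw [← ENNReal.tsum_mul_right]
    calc ∑' q : Mx, μ (dyadicCube q.1) * t ≤ ∑' q : Mx, ∫⁻ x in dyadicCube q.1, h x ∂μ :=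
          ENNReal.tsum_le_tsum fun q => (mul_comm _ _).trans_le (hE' q.1 q.2.1)
      _ = ∫⁻ x in ⋃ q ∈ Mx, dyadicCube q, h x ∂μ :=
          (lintegral_biUnion (Set.to_countable _) (fun q _ => measurableSet_dyadicCube q)
            hdisj _).symm
      _ ≤ _ := lintegral_mono_set (Set.iUnion₂_subset fun q hq => hE q hq.1)
  calc (∑' p : E, α p) * t ≤ A * (∑' q : Mx, μ (dyadicCube q.1)) * t := mul_le_mul_left h1 t
    _ = A * ((∑' q : Mx, μ (dyadicCube q.1)) * t) := mul_assoc _ _ _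
    _ ≤ _ := mul_le_mul_right h2 A

/-- The layer cake formula for a Dirac mass. -/
theorem ofReal_sq_eq_lintegral {x : ℝ} (hx : 0 ≤ x) :
    ENNReal.ofReal x ^ 2 =
      2 * ∫⁻ t in Set.Ioi (0 : ℝ), (if t < x then 1 else 0) * ENNReal.ofReal t := by
  have h := lintegral_rpow_eq_lintegral_meas_lt_mul (Measure.dirac ()) (f := fun _ => x)
    (Eventually.of_forall fun _ => hx) aemeasurable_const (p := 2) (by norm_num)
  rw [lintegral_dirac, ENNReal.ofReal_ofNat, Real.rpow_ofNat, ENNReal.ofReal_pow hx] at h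
  rw [h]
  congr 1
  refine lintegral_congr fun t => ?_
  by_cases ht : t < x
  · norm_num [ht]
  · norm_num [ht]

/-- The dyadic Carleson embedding theorem. -/
theorem carleson_embedding (hn : n ≠ 0) (μ : Measure (Euc n)) (p₀ : ℤ × (Fin n → ℤ))
    (hμ : μ (dyadicCube p₀) ≠ ⊤) (a : ℤ × (Fin n → ℤ) → ℝ≥0∞) (A : ℝ≥0∞)
    (hA : ∀ q, dyadicCube q ⊆ dyadicCube p₀ →
      ∑' p : {p | dyadicCube p ⊆ dyadicCube q}, a p * μ (dyadicCube p) ^ 2 ≤ A * μ (dyadicCube q))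
    {f : Euc n → ℝ} (hf : Measurable f)
    (hfi : ∫⁻ x in dyadicCube p₀, ENNReal.ofReal (f x) ∂μ ≠ ⊤) :
    ∑' p : {p | dyadicCube p ⊆ dyadicCube p₀},
      a p * (∫⁻ x in dyadicCube p, ENNReal.ofReal (f x) ∂μ) ^ 2 ≤
        8 * A * ∫⁻ x in dyadicCube p₀, ENNReal.ofReal (f x) ^ 2 ∂μ := by
  set I : Set (ℤ × (Fin n → ℤ)) := {p | dyadicCube p ⊆ dyadicCube p₀} with hI
  set α : ℤ × (Fin n → ℤ) → ℝ≥0∞ := fun p => a p * μ (dyadicCube p) ^ 2 with hα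
  set c : ℤ × (Fin n → ℤ) → ℝ≥0∞ := fun p => ∫⁻ x in dyadicCube p, ENNReal.ofReal (f x) ∂μ with hc
  set X : ℤ × (Fin n → ℤ) → ℝ := fun p => (c p / μ (dyadicCube p)).toReal with hX
  have hμp : ∀ p : I, μ (dyadicCube p.1) ≠ ⊤ := fun p =>
    ne_top_of_le_ne_top hμ (measure_mono p.2)
  have hcp : ∀ p : I, c p ≠ ⊤ := fun p => ne_top_of_le_ne_top hfi (lintegral_mono_set p.2)
  have hc0 : ∀ p, μ (dyadicCube p) = 0 → c p = 0 := fun p hp => setLIntegral_measure_zero _ _ hp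
  have hXp : ∀ p : I, μ (dyadicCube p.1) ≠ 0 → ENNReal.ofReal (X p) = c p / μ (dyadicCube p.1) :=
    fun p hp => ENNReal.ofReal_toReal (ENNReal.div_ne_top (hcp p) hp)
  have hterm : ∀ p : I, a p * c p ^ 2 = α p * ENNReal.ofReal (X p) ^ 2 := fun p => by
    by_cases hp : μ (dyadicCube p.1) = 0
    · simp [hα, hc0 _ hp, hp]
    · rw [hXp p hp, hα, mul_assoc, ← mul_pow, ENNReal.mul_div_cancel hp (hμp p)]
  set F : I → ℝ → ℝ≥0∞ := fun p t => α p * ((if t < X p then 1 else 0) * ENNReal.ofReal t) with hF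
  have hFm : ∀ p, Measurable (F p) := fun p =>
    ((Measurable.ite measurableSet_Iio measurable_const measurable_const).mul
      ENNReal.measurable_ofReal).const_mul _
  -- Real interpolation: the part of `f` below `t / 2` contributes at most `t / 2` to an average, so
  -- an average above `t` forces the average of the part above `t / 2` to be at least `t / 2`. The
  -- weak type estimate is applied to that part.
  have hlevel : ∀ t ∈ Set.Ioi (0 : ℝ), ∑' p : I, F p t ≤
      2 * A * ∫⁻ x in dyadicCube p₀, ENNReal.ofReal (f x) * (if t < 2 * f x then 1 else 0) ∂μ := by
    intro t ht
    have ht' : (0 : ℝ) < t := ht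
    set g : Euc n → ℝ≥0∞ := fun x => ENNReal.ofReal (f x) * (if t < 2 * f x then 1 else 0) with hg
    set E : Set (ℤ × (Fin n → ℤ)) := {p | p ∈ I ∧ t < X p} with hE
    have hmain := carleson_weak_type hn μ p₀ α A hA g (ENNReal.ofReal (t / 2)) E (fun p hp => hp.1)
      (fun p hp => by
        by_cases hp0 : μ (dyadicCube p) = 0
        · simp [hp0]
        have h1 : ENNReal.ofReal t * μ (dyadicCube p) ≤ c p := by
          rw [← ENNReal.le_div_iff_mul_le (Or.inl hp0) (Or.inl (hμp ⟨p, hp.1⟩)),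
            ← hXp ⟨p, hp.1⟩ hp0]
          exact ENNReal.ofReal_le_ofReal hp.2.le
        have h2 : c p ≤ ∫⁻ x in dyadicCube p, g x ∂μ + ENNReal.ofReal (t / 2) * μ (dyadicCube p) := by
          rw [← setLIntegral_const, ← lintegral_add_right _ measurable_const]
          refine lintegral_mono fun x => ?_
          by_cases hx : t < 2 * f x
          · simp [hg, hx]
          · simp only [hg, hx, if_false, mul_zero, zero_add]
            exact ENNReal.ofReal_le_ofReal (by linarith)
        have h3 : ENNReal.ofReal t = ENNReal.ofReal (t / 2) + ENNReal.ofReal (t / 2) := by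
          rw [← ENNReal.ofReal_add (by positivity) (by positivity)]; congr 1; ring
        rw [h3, add_mul] at h1
        exact (ENNReal.add_le_add_iff_right
          (ENNReal.mul_ne_top ENNReal.ofReal_ne_top (hμp ⟨p, hp.1⟩))).1 (h1.trans h2))
    have hsum : ∑' p : I, F p t = (∑' p : E, α p) * ENNReal.ofReal t := by
      rw [← ENNReal.tsum_mul_right, tsum_subtype E fun p => α p * ENNReal.ofReal t,
        tsum_subtype I fun p => α p * ((if t < X p then 1 else 0) * ENNReal.ofReal t)]
      congr 1; funext p
      by_cases h1 : p ∈ I <;> by_cases h2 : t < X p <;> simp [E, h1, h2]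
    rw [hsum, show ENNReal.ofReal t = 2 * ENNReal.ofReal (t / 2) by
      rw [← ENNReal.ofReal_ofNat, ← ENNReal.ofReal_mul (by norm_num)]; congr 1; ring]
    calc _ = 2 * ((∑' p : E, α p) * ENNReal.ofReal (t / 2)) := by ring
      _ ≤ 2 * (A * ∫⁻ x in dyadicCube p₀, g x ∂μ) := by gcongr
      _ = _ := by ring
  -- The `t`-integral of the cutoff is `2 f`. With the 2 of the layer cake and the 2 of the level
  -- estimate this gives the constant 8.
  have hsw : ∫⁻ t in Set.Ioi (0 : ℝ), ∫⁻ x in dyadicCube p₀,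
      ENNReal.ofReal (f x) * (if t < 2 * f x then 1 else 0) ∂μ =
        2 * ∫⁻ x in dyadicCube p₀, ENNReal.ofReal (f x) ^ 2 ∂μ := by
    have : IsFiniteMeasure (μ.restrict (dyadicCube p₀)) := ⟨by simpa using hμ.lt_top⟩
    rw [lintegral_lintegral_swap]
    · rw [← lintegral_const_mul _ (hf.ennreal_ofReal.pow_const 2)]
      refine lintegral_congr fun x => ?_
      have hset : ∀ t, (if t < 2 * f x then (1 : ℝ≥0∞) else 0) =
          (Set.Iio (2 * f x)).indicator (fun _ => 1) t := fun t => by simp [Set.indicator]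
      rw [lintegral_const_mul _ (Measurable.ite measurableSet_Iio measurable_const measurable_const)]
      simp_rw [hset]
      rw [lintegral_indicator_const measurableSet_Iio, Measure.restrict_apply measurableSet_Iio,
        Set.inter_comm, Set.Ioi_inter_Iio, Real.volume_Ioo, sub_zero,
        ENNReal.ofReal_mul (by norm_num), ENNReal.ofReal_ofNat]
      ring
    · refine Measurable.aemeasurable ?_
      refine (hf.ennreal_ofReal.comp measurable_snd).mul
        (Measurable.ite ?_ measurable_const measurable_const)
      exact measurableSet_lt measurable_fst ((hf.comp measurable_snd).const_mul 2)
  calc ∑' p : I, a p * c p ^ 2 = ∑' p : I, 2 * ∫⁻ t in Set.Ioi (0 : ℝ), F p t := by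
        congr 1; funext p
        rw [hterm, ofReal_sq_eq_lintegral ENNReal.toReal_nonneg, hF, lintegral_const_mul]
        · ring
        · exact (Measurable.ite measurableSet_Iio measurable_const measurable_const).mul
            ENNReal.measurable_ofReal
    _ = 2 * ∫⁻ t in Set.Ioi (0 : ℝ), ∑' p : I, F p t := by
        rw [ENNReal.tsum_mul_left, lintegral_tsum fun p => (hFm p).aemeasurable]
    _ ≤ 2 * ∫⁻ t in Set.Ioi (0 : ℝ), 2 * A * ∫⁻ x in dyadicCube p₀,
          ENNReal.ofReal (f x) * (if t < 2 * f x then 1 else 0) ∂μ := by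
        gcongr 2 * ?_
        exact setLIntegral_mono' measurableSet_Ioi hlevel
    _ = _ := by
        rw [lintegral_const_mul'', hsw]
        · ring
        · have : IsFiniteMeasure (μ.restrict (dyadicCube p₀)) := ⟨by simpa using hμ.lt_top⟩
          refine Measurable.aemeasurable (Measurable.lintegral_prod_right' (f := fun q : ℝ × Euc n =>
            ENNReal.ofReal (f q.2) * (if q.1 < 2 * f q.2 then 1 else 0)) ?_)
          refine (hf.ennreal_ofReal.comp measurable_snd).mul
            (Measurable.ite ?_ measurable_const measurable_const)
          exact measurableSet_lt measurable_fst ((hf.comp measurable_snd).const_mul 2)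

/-! ### Cauchy–Schwarz, gradients and changes of variables. -/

theorem lintegral_mul_sq_le {X : Type*} [MeasurableSpace X] (μ : Measure X) {f g : X → ℝ≥0∞}
    (hf : AEMeasurable f μ) (hg : AEMeasurable g μ) :
    (∫⁻ x, f x * g x ∂μ) ^ 2 ≤ (∫⁻ x, f x ^ 2 ∂μ) * ∫⁻ x, g x ^ 2 ∂μ := by
  have h := ENNReal.lintegral_mul_le_Lp_mul_Lq μ Real.HolderConjugate.two_two hf hg
  simp only [Pi.mul_apply, ENNReal.rpow_ofNat] at h
  calc _ ≤ _ := pow_le_pow_left' h 2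
    _ = _ := by
      rw [mul_pow, ← ENNReal.rpow_natCast, ← ENNReal.rpow_natCast (_ ^ (1 / 2 : ℝ)),
        ← ENNReal.rpow_mul, ← ENNReal.rpow_mul]
      norm_num

theorem ENNReal_add_sq_le (a b : ℝ≥0∞) : (a + b) ^ 2 ≤ 4 * (a ^ 2 + b ^ 2) := by
  rcases le_total a b with h | h
  · calc (a + b) ^ 2 ≤ (b + b) ^ 2 := by gcongr
      _ = 4 * b ^ 2 := by ring
      _ ≤ _ := by gcongr; exact le_add_self
  · calc (a + b) ^ 2 ≤ (a + a) ^ 2 := by gcongr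
      _ = 4 * a ^ 2 := by ring
      _ ≤ _ := by gcongr; exact le_self_add

section Gradient

variable {F : Type*} [NormedAddCommGroup F] [NormedSpace ℝ F]

/-- The operator norm is at most the Hilbert–Schmidt norm. Together with `sum_enorm_clm_sq_le` this
makes the operator norm of `fderiv` interchangeable with the integrand of `gradSq`, up to a factor
`n`. -/
theorem enorm_clm_sq_le (L : Euc n →L[ℝ] F) :
    ‖L‖ₑ ^ 2 ≤ ∑ i : Fin n, ‖L (EuclideanSpace.single i (1 : ℝ))‖ₑ ^ 2 := by
  set S : ℝ := ∑ i : Fin n, ‖L (EuclideanSpace.single i (1 : ℝ))‖ ^ 2 with hS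
  have hS0 : 0 ≤ S := by positivity
  have h1 : ‖L‖ ≤ √S := by
    refine L.opNorm_le_bound (Real.sqrt_nonneg _) fun x => ?_
    have hx : L x = ∑ i, x i • L (EuclideanSpace.single i (1 : ℝ)) := by
      conv_lhs => rw [← (EuclideanSpace.basisFun (Fin n) ℝ).sum_repr x]
      simp [map_sum]
    rw [hx]
    calc ‖∑ i, x i • L (EuclideanSpace.single i (1 : ℝ))‖
        ≤ ∑ i, ‖x i‖ * ‖L (EuclideanSpace.single i (1 : ℝ))‖ :=
          (norm_sum_le _ _).trans_eq (by simp_rw [norm_smul])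
      _ ≤ √(∑ i, ‖x i‖ ^ 2) * √S := Real.sum_mul_le_sqrt_mul_sqrt _ _ _
      _ = _ := by rw [← EuclideanSpace.norm_eq, mul_comm]
  have h2 : ‖L‖ ^ 2 ≤ S := (Real.le_sqrt (norm_nonneg _) hS0).1 h1
  calc ‖L‖ₑ ^ 2 = ENNReal.ofReal (‖L‖ ^ 2) := by
        rw [ENNReal.ofReal_pow (norm_nonneg _), ofReal_norm]
    _ ≤ ENNReal.ofReal S := ENNReal.ofReal_le_ofReal h2
    _ = _ := by
        rw [hS, ENNReal.ofReal_sum_of_nonneg fun _ _ => by positivity]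
        simp_rw [ENNReal.ofReal_pow (norm_nonneg _), ofReal_norm]

theorem sum_enorm_clm_sq_le (L : Euc n →L[ℝ] F) :
    ∑ i : Fin n, ‖L (EuclideanSpace.single i (1 : ℝ))‖ₑ ^ 2 ≤ n * ‖L‖ₑ ^ 2 := by
  calc _ ≤ ∑ _i : Fin n, ‖L‖ₑ ^ 2 := by
        gcongr with i
        have := L.le_opENorm (EuclideanSpace.single i (1 : ℝ))
        simpa [enorm_eq_nnnorm] using this
    _ = _ := by simp

theorem enorm_sub_le_lintegral_fderiv [CompleteSpace F] {u : Euc n → F} (hu : ContDiff ℝ 1 u)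
    (x h : Euc n) :
    ‖u (x + h) - u x‖ₑ ≤ ∫⁻ t in Set.Icc (0 : ℝ) 1, ‖fderiv ℝ u (x + t • h)‖ₑ * ‖h‖ₑ := by
  have hd : ∀ t : ℝ, HasDerivAt (fun t : ℝ => u (x + t • h)) (fderiv ℝ u (x + t • h) h) t :=
    fun t => by
      have h1 : HasDerivAt (fun t : ℝ => x + t • h) h t := by
        simpa using ((hasDerivAt_id t).smul_const h).const_add x
      exact (hu.differentiable one_ne_zero _).hasFDerivAt.comp_hasDerivAt t h1
  have hc : Continuous fun t : ℝ => fderiv ℝ u (x + t • h) h :=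
    ((hu.continuous_fderiv one_ne_zero).comp (by fun_prop)).clm_apply continuous_const
  have hI := intervalIntegral.integral_eq_sub_of_hasDerivAt (a := 0) (b := 1) (fun t _ => hd t)
    (hc.intervalIntegrable _ _)
  simp only [one_smul, zero_smul, add_zero] at hI
  rw [← hI, intervalIntegral.integral_of_le zero_le_one]
  calc _ ≤ ∫⁻ t in Set.Ioc (0 : ℝ) 1, ‖fderiv ℝ u (x + t • h) h‖ₑ := enorm_integral_le_lintegral_enorm _
    _ ≤ ∫⁻ t in Set.Icc (0 : ℝ) 1, ‖fderiv ℝ u (x + t • h) h‖ₑ :=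
        lintegral_mono_set Set.Ioc_subset_Icc_self
    _ ≤ _ := lintegral_mono fun t => (fderiv ℝ u (x + t • h)).le_opENorm h

end Gradient

theorem lintegral_comp_add_smul (f : Euc n → ℝ≥0∞) (b : Euc n) {c : ℝ} (hc : 0 < c) :
    ∫⁻ z, f (b + c • z) = ENNReal.ofReal ((c ^ n)⁻¹) * ∫⁻ y, f y := by
  have h1 : ∫⁻ z, f (b + c • z) = ∫⁻ y, f (b + y) ∂(Measure.map (fun z : Euc n => c • z) volume) :=
    ((MeasurableEquiv.smul₀ c hc.ne').measurableEmbedding.lintegral_map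
      (fun y => f (b + y))).symm
  rw [h1, Measure.map_addHaar_smul _ hc.ne', lintegral_smul_measure, smul_eq_mul,
    finrank_euclideanSpace_fin, abs_of_pos (by positivity), lintegral_add_left_eq_self]

/-- The affine parametrization of the dyadic cube with index `p` by the unit cube. -/
noncomputable def chart (p : ℤ × (Fin n → ℤ)) (z : Euc n) : Euc n :=
  corner p + (2 : ℝ) ^ (-p.1) • z

/-- The half-open unit cube. -/
def unitCube (n : ℕ) : Set (Euc n) := dyadicCube (0, 0)

theorem measurableSet_unitCube : MeasurableSet (unitCube n) := measurableSet_dyadicCube _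

theorem volume_unitCube : volume (unitCube n) = 1 := by
  rw [unitCube, volume_dyadicCube]; simp

theorem chart_mem {p : ℤ × (Fin n → ℤ)} {z : Euc n} (hz : z ∈ unitCube n) :
    chart p z ∈ dyadicCube p := fun i => by
  have h : (0 : ℝ) < 2 ^ (-p.1) := by positivity
  have hi := hz i
  simp at hi
  simp only [chart, corner, PiLp.add_apply, PiLp.smul_apply, smul_eq_mul]
  constructor <;> nlinarith

theorem continuous_chart (p : ℤ × (Fin n → ℤ)) : Continuous (chart p) := by
  unfold chart; fun_prop

theorem setLIntegral_unitCube_comp_le (f : Euc n → ℝ≥0∞) (b : Euc n) {c : ℝ} (hc : 0 < c)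
    {P : Set (Euc n)} (hP : MeasurableSet P) (hsub : ∀ z ∈ unitCube n, b + c • z ∈ P) :
    ∫⁻ z in unitCube n, f (b + c • z) ≤ ENNReal.ofReal ((c ^ n)⁻¹) * ∫⁻ y in P, f y := by
  rw [← lintegral_indicator hP, ← lintegral_comp_add_smul _ b hc,
    ← lintegral_indicator measurableSet_unitCube]
  refine lintegral_mono fun z => ?_
  by_cases hz : z ∈ unitCube n
  · simp [hz, hsub z hz]
  · simp [hz]

/-! ### Averages over dyadic cubes and their telescoping. -/

section Average

variable {F : Type*} [NormedAddCommGroup F] [NormedSpace ℝ F]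

/-- The average of `u` over the dyadic cube with index `p`. -/
noncomputable def cubeAvg (p : ℤ × (Fin n → ℤ)) (u : Euc n → F) : F :=
  ∫ z in unitCube n, u (chart p z)

theorem enorm_cubeAvg_sq_le (p : ℤ × (Fin n → ℤ)) {u : Euc n → F} (hu : Continuous u) :
    ‖cubeAvg p u‖ₑ ^ 2 ≤ 2 ^ (p.1 * n) * ∫⁻ x in dyadicCube p, ‖u x‖ₑ ^ 2 := by
  have h1 : ‖cubeAvg p u‖ₑ ≤ ∫⁻ z in unitCube n, 1 * ‖u (chart p z)‖ₑ := by
    simp_rw [one_mul]; exact enorm_integral_le_lintegral_enorm _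
  have hm : Measurable fun z => ‖u (chart p z)‖ₑ :=
    (continuous_enorm.comp (hu.comp (continuous_chart p))).measurable
  calc _ ≤ _ := pow_le_pow_left' h1 2
    _ ≤ _ := lintegral_mul_sq_le _ measurable_const.aemeasurable hm.aemeasurable
    _ = ∫⁻ z in unitCube n, ‖u (chart p z)‖ₑ ^ 2 := by simp [volume_unitCube]
    _ ≤ _ := setLIntegral_unitCube_comp_le (fun x => ‖u x‖ₑ ^ 2) (corner p) (by positivity)
        (measurableSet_dyadicCube p) fun z hz => chart_mem hz
    _ = _ := by
        rw [← zpow_natCast, ← zpow_mul, ← zpow_neg, ofReal_two_zpow]; congr 2; ring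

theorem integrableOn_comp_chart {G : Type*} [NormedAddCommGroup G] {u : Euc n → G} (hu : Continuous u) (hc : HasCompactSupport u)
    (p : ℤ × (Fin n → ℤ)) : IntegrableOn (fun z => u (chart p z)) (unitCube n) := by
  obtain ⟨C, hC⟩ := hu.bounded_above_of_compact_support hc
  refine Measure.integrableOn_of_bounded (M := C) (by simp [volume_unitCube]) ?_
    (Eventually.of_forall fun z => hC _)
  exact (hu.comp (continuous_chart p)).aestronglyMeasurable

/-- The two averages are coupled through the same point `z` of the unit cube. At each time `t` the
segments between the two images form an affine copy of the unit cube inside `p`, of side at least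
that of `q`, so the Jacobian of the change of variables stays bounded and no singular kernel
appears. -/
theorem enorm_cubeAvg_sub_le [CompleteSpace F] {u : Euc n → F} (hu : ContDiff ℝ 1 u)
    (hc : HasCompactSupport u) {p q : ℤ × (Fin n → ℤ)} (hl : q.1 = p.1 + 1)
    (hpq : dyadicCube q ⊆ dyadicCube p) :
    ‖cubeAvg p u - cubeAvg q u‖ₑ ≤
      n * 2 ^ n * (2 ^ (p.1 * ((n : ℤ) - 1)) * ∫⁻ x in dyadicCube p, ‖fderiv ℝ u x‖ₑ) := by
  have hs : (0 : ℝ) < 2 ^ (-p.1) := by positivity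
  have hq : (2 : ℝ) ^ (-q.1) = 2 ^ (-p.1) / 2 := by
    rw [hl, neg_add, zpow_add₀ (by norm_num), zpow_neg_one, div_eq_mul_inv]
  set b : ℝ → Euc n := fun t => (1 - t) • corner q + t • corner p with hb
  set c : ℝ → ℝ := fun t => (1 + t) * (2 ^ (-p.1) / 2) with hcdef
  have hpath : ∀ (t : ℝ) (z : Euc n), chart q z + t • (chart p z - chart q z) = b t + c t • z :=
    fun t z => by
      ext i
      simp only [chart, hb, hcdef, hq, PiLp.add_apply, PiLp.smul_apply, PiLp.sub_apply, smul_eq_mul]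
      ring
  have hmem : ∀ t ∈ Set.Icc (0 : ℝ) 1, ∀ z ∈ unitCube n, b t + c t • z ∈ dyadicCube p := by
    rintro t ⟨ht0, ht1⟩ z hz
    rw [← hpath]
    intro i
    have h1 := chart_mem (p := p) hz i
    have h2 := hpq (chart_mem (p := q) hz) i
    simp only [PiLp.add_apply, PiLp.smul_apply, PiLp.sub_apply, smul_eq_mul]
    constructor
    · nlinarith
    · rcases ht0.eq_or_lt with rfl | ht
      · simpa using h2.2
      · nlinarith
  have hfm : Measurable fun x => ‖fderiv ℝ u x‖ₑ :=
    (continuous_enorm.comp (hu.continuous_fderiv one_ne_zero)).measurable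
  have hdist : ∀ z ∈ unitCube n, ‖chart p z - chart q z‖ₑ ≤ n * 2 ^ (-p.1) := fun z hz => by
    have := dist_le_of_mem_dyadicCube (chart_mem (p := p) hz) (hpq (chart_mem (p := q) hz))
    rw [← ofReal_norm, ← dist_eq_norm, ← ofReal_two_zpow, ← ENNReal.ofReal_natCast,
      ← ENNReal.ofReal_mul (by positivity)]
    exact ENNReal.ofReal_le_ofReal this
  rw [cubeAvg, cubeAvg, ← integral_sub (integrableOn_comp_chart hu.continuous hc p)
    (integrableOn_comp_chart hu.continuous hc q)]
  calc ‖∫ z in unitCube n, (u (chart p z) - u (chart q z))‖ₑ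
      ≤ ∫⁻ z in unitCube n, ‖u (chart p z) - u (chart q z)‖ₑ := enorm_integral_le_lintegral_enorm _
    _ ≤ ∫⁻ z in unitCube n, ∫⁻ t in Set.Icc (0 : ℝ) 1,
          ‖fderiv ℝ u (b t + c t • z)‖ₑ * (n * 2 ^ (-p.1)) := by
        refine setLIntegral_mono' measurableSet_unitCube fun z hz => ?_
        have h := enorm_sub_le_lintegral_fderiv hu (chart q z) (chart p z - chart q z)
        rw [add_sub_cancel] at h
        simp_rw [hpath] at h
        refine h.trans (lintegral_mono fun t => ?_)
        gcongr
        exact hdist z hz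
    _ = ∫⁻ t in Set.Icc (0 : ℝ) 1, ∫⁻ z in unitCube n,
          ‖fderiv ℝ u (b t + c t • z)‖ₑ * (n * 2 ^ (-p.1)) := by
        rw [lintegral_lintegral_swap]
        refine Measurable.aemeasurable (Measurable.mul_const (hfm.comp ?_) _)
        simp only [hb, hcdef]
        fun_prop
    _ ≤ ∫⁻ t in Set.Icc (0 : ℝ) 1,
          2 ^ ((p.1 + 1) * n) * (∫⁻ x in dyadicCube p, ‖fderiv ℝ u x‖ₑ) * (n * 2 ^ (-p.1)) := by
        refine setLIntegral_mono' measurableSet_Icc fun t ht => ?_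
        have hct : (2 : ℝ) ^ (-p.1) / 2 ≤ c t := by simp only [hcdef]; nlinarith [ht.1]
        have hm : Measurable fun z => ‖fderiv ℝ u (b t + c t • z)‖ₑ := hfm.comp (by fun_prop)
        rw [lintegral_mul_const _ hm]
        gcongr
        refine (setLIntegral_unitCube_comp_le (fun x => ‖fderiv ℝ u x‖ₑ) (b t) (by linarith)
          (measurableSet_dyadicCube p) (hmem t ht)).trans ?_
        gcongr
        rw [← ofReal_two_zpow]
        refine ENNReal.ofReal_le_ofReal ?_
        calc (c t ^ n)⁻¹ ≤ (((2 : ℝ) ^ (-p.1) / 2) ^ n)⁻¹ := by gcongr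
          _ = _ := by
            rw [← hq, hl, ← zpow_natCast, ← zpow_mul, ← zpow_neg]; congr 1; ring
    _ = 2 ^ ((p.1 + 1) * n) * (∫⁻ x in dyadicCube p, ‖fderiv ℝ u x‖ₑ) * (n * 2 ^ (-p.1)) := by
        simp
    _ = n * (2 ^ ((p.1 + 1) * n) * 2 ^ (-p.1)) * ∫⁻ x in dyadicCube p, ‖fderiv ℝ u x‖ₑ := by ring
    _ = n * (2 ^ (n : ℤ) * 2 ^ (p.1 * ((n : ℤ) - 1))) * ∫⁻ x in dyadicCube p, ‖fderiv ℝ u x‖ₑ := by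
        rw [← two_zpow_add, ← two_zpow_add]; congr 3; ring
    _ = _ := by rw [zpow_natCast]; ring

theorem tendsto_cubeAvg [CompleteSpace F] {u : Euc n → F} (hu : Continuous u)
    (hc : HasCompactSupport u) (k : ℤ) (x : Euc n) :
    Tendsto (fun j : ℕ => cubeAvg (k + j, idx (k + j) x) u) atTop (𝓝 (u x)) := by
  rw [Metric.tendsto_atTop]
  intro ε hε
  obtain ⟨δ, hδ, hδ'⟩ := Metric.continuousAt_iff.1 (hu.continuousAt (x := x)) (ε / 2) (by positivity)
  have hlim : Tendsto (fun j : ℕ => (n : ℝ) * 2 ^ (-k) * (1 / 2) ^ j) atTop (𝓝 0) := by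
    simpa using (tendsto_pow_atTop_nhds_zero_of_lt_one (r := (1 / 2 : ℝ)) (by norm_num)
      (by norm_num)).const_mul ((n : ℝ) * 2 ^ (-k))
  obtain ⟨J, hJ⟩ := eventually_atTop.1 (hlim.eventually (gt_mem_nhds hδ))
  refine ⟨J, fun j hj => ?_⟩
  set p : ℤ × (Fin n → ℤ) := (k + j, idx (k + j) x) with hp
  have hside : (n : ℝ) * 2 ^ (-p.1) < δ := by
    have h2 : (2 : ℝ) ^ (-(k + (j : ℤ))) = 2 ^ (-k) * (1 / 2) ^ j := by
      rw [neg_add, zpow_add₀ (by norm_num), zpow_neg _ (j : ℤ), zpow_natCast, one_div, inv_pow]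
    calc (n : ℝ) * 2 ^ (-p.1) = n * 2 ^ (-k) * (1 / 2) ^ j := by rw [mul_assoc, ← h2]
      _ < δ := hJ j hj
  have hsub : cubeAvg p u - u x = ∫ z in unitCube n, (u (chart p z) - u x) := by
    rw [integral_sub (integrableOn_comp_chart hu hc p)
      (integrableOn_const (by simp [volume_unitCube]))]
    simp [cubeAvg, measureReal_def, volume_unitCube]
  rw [dist_eq_norm, hsub]
  have hb := norm_setIntegral_le_of_norm_le_const (μ := volume) (s := unitCube n) (C := ε / 2)
    (f := fun z => u (chart p z) - u x) (by simp [volume_unitCube]) fun z hz => by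
      rw [← dist_eq_norm]
      refine (hδ' ?_).le
      exact (dist_le_of_mem_dyadicCube (chart_mem hz) (mem_dyadicCube_iff.2 rfl)).trans_lt hside
  simp only [measureReal_def, volume_unitCube, ENNReal.toReal_one, mul_one] at hb
  linarith

/-- Telescoping of the averages over the dyadic cubes that contain `x`. -/
theorem enorm_le_cubeAvg_add_tsum [CompleteSpace F] {u : Euc n → F} (hu : ContDiff ℝ 1 u)
    (hc : HasCompactSupport u) {p : ℤ × (Fin n → ℤ)} {x : Euc n} (hx : x ∈ dyadicCube p) :
    ‖u x‖ₑ ≤ ‖cubeAvg p u‖ₑ + ∑' j : ℕ, n * 2 ^ n * (2 ^ ((p.1 + j) * ((n : ℤ) - 1)) *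
      ∫⁻ y in near 0 (p.1 + j) x, ‖fderiv ℝ u y‖ₑ) := by
  have h := edist_le_tsum_of_edist_le_of_tendsto₀ (f := fun j : ℕ => cubeAvg (p.1 + j, idx (p.1 + j) x) u)
    (fun j : ℕ => n * 2 ^ n * (2 ^ ((p.1 + j) * ((n : ℤ) - 1)) *
      ∫⁻ y in near 0 (p.1 + j) x, ‖fderiv ℝ u y‖ₑ)) (fun j => by
        rw [edist_eq_enorm_sub, near_zero_eq]
        refine enorm_cubeAvg_sub_le hu hc (by push_cast; ring) ?_
        exact dyadicCube_subset_of_mem (by simp) (mem_dyadicCube_iff.2 rfl)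
          (mem_dyadicCube_iff.2 rfl)) (tendsto_cubeAvg hu.continuous hc p.1 x)
  have hp : ((p.1 + (0 : ℕ) : ℤ), idx (p.1 + (0 : ℕ)) x) = p := by
    refine Prod.ext (by simp) ?_
    simpa using mem_dyadicCube_iff.1 hx
  simp only [hp] at h
  calc ‖u x‖ₑ = ‖cubeAvg p u + (u x - cubeAvg p u)‖ₑ := by congr 1; abel
    _ ≤ ‖cubeAvg p u‖ₑ + ‖u x - cubeAvg p u‖ₑ := enorm_add_le _ _
    _ ≤ _ := by
        gcongr
        rw [← edist_eq_enorm_sub, edist_comm]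
        exact h

end Average

/-! ### From the Carleson condition to form boundedness. -/

variable {𝕜 : Type*} [RCLike 𝕜]

theorem measure_dyadicCube_ne_top (μ : Measure (Euc n)) [IsLocallyFiniteMeasure μ]
    (p : ℤ × (Fin n → ℤ)) : μ (dyadicCube p) ≠ ⊤ :=
  (isBounded_dyadicCube p).measure_lt_top.ne

theorem setLIntegral_enorm_sq_ne_top {F : Type*} [NormedAddCommGroup F] (μ : Measure (Euc n))
    {u : Euc n → F} (hu : Continuous u) (hc : HasCompactSupport u)
    {P : Set (Euc n)} (hP : μ P ≠ ⊤) (m : ℕ) : ∫⁻ x in P, ‖u x‖ₑ ^ m ∂μ ≠ ⊤ := by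
  obtain ⟨C, hC⟩ := hu.bounded_above_of_compact_support hc
  refine ne_top_of_le_ne_top (b := ENNReal.ofReal C ^ m * μ P)
    (ENNReal.mul_ne_top (by simp) hP) ?_
  rw [← setLIntegral_const]
  refine lintegral_mono fun x => ?_
  rw [← ofReal_norm]
  gcongr
  exact hC x

/-- Under the Carleson condition, the trace inequality holds on a dyadic cube up to the average. -/
theorem setLIntegral_sq_le_of_carleson (hn : n ≠ 0) (μ : Measure (Euc n)) [IsLocallyFiniteMeasure μ]
    (p₀ : ℤ × (Fin n → ℤ)) (A : ℝ≥0∞)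
    (hA : ∀ q, dyadicCube q ⊆ dyadicCube p₀ → carlesonSum μ q ≤ A * μ (dyadicCube q))
    {u : Euc n → 𝕜} (hu : ContDiff ℝ 1 u) (hc : HasCompactSupport u) :
    ∫⁻ x in dyadicCube p₀, ‖u x‖ₑ ^ 2 ∂μ ≤
      4 * ‖cubeAvg p₀ u‖ₑ ^ 2 * μ (dyadicCube p₀) +
        128 * (n * 2 ^ n) ^ 2 * A * ∫⁻ x in dyadicCube p₀, ‖fderiv ℝ u x‖ₑ ^ 2 := by
  set P := dyadicCube p₀ with hP
  have hPm : MeasurableSet P := measurableSet_dyadicCube p₀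
  set N := ∫⁻ x in P, ‖u x‖ₑ ^ 2 ∂μ with hN
  set H := ∫⁻ x in P, ‖fderiv ℝ u x‖ₑ ^ 2 with hH
  set C : ℝ≥0∞ := n * 2 ^ n with hC
  set a := ‖cubeAvg p₀ u‖ₑ with ha
  have hμP : μ P ≠ ⊤ := measure_dyadicCube_ne_top μ p₀
  have hNtop : N ≠ ⊤ := setLIntegral_enorm_sq_ne_top μ hu.continuous hc hμP 2
  have hgm : Measurable fun x => ‖u x‖ₑ := (continuous_enorm.comp hu.continuous).measurable
  have hfm : Measurable fun x => ‖fderiv ℝ u x‖ₑ :=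
    (continuous_enorm.comp (hu.continuous_fderiv one_ne_zero)).measurable
  -- Duality: one factor of `|u|²` goes into the measure, the other is expanded by telescoping.
  set ν₀ : Measure (Euc n) := μ.withDensity fun x => ‖u x‖ₑ with hν₀
  set ν := ν₀.restrict P with hν
  have hνP : ∀ p, ν₀ (dyadicCube p) = ∫⁻ x in dyadicCube p, ‖u x‖ₑ ∂μ := fun p =>
    withDensity_apply _ (measurableSet_dyadicCube p)
  have hνint : ∀ f : Euc n → ℝ≥0∞, Measurable f → ∫⁻ x, f x ∂ν = ∫⁻ x in P, ‖u x‖ₑ * f x ∂μ :=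
    fun f hf => by
      rw [hν, hν₀, restrict_withDensity hPm, lintegral_withDensity_eq_lintegral_mul _ hgm hf]; rfl
  -- the energy of `ν`
  set V : Euc n → ℝ≥0∞ := fun y =>
    ∑' j : ℕ, 2 ^ ((p₀.1 + j) * ((n : ℤ) - 1)) * ν (near 0 (p₀.1 + j) y) with hV
  have hVm : Measurable V := Measurable.tsum fun j => (measurable_measure_near ν 0 _).const_mul _
  -- The Wolff-type estimate with `r = 0` reduces the energy to weighted squares of the integrals of
  -- `|u|` over the cubes, and the Carleson embedding with `f = |u|` bounds these: 32 = 4 · 8.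
  have henergy : ∫⁻ y, V y ^ 2 ≤ 32 * A * N := by
    have h1 := lintegral_sq_tsum_measure_near_le ν 0 p₀.1 1 fun _ => le_rfl
    simp only [Pi.one_apply, one_mul] at h1
    have h2 := tsum_level_sq hn ν₀ p₀
    have h3 := carleson_embedding hn μ p₀ hμP
      (fun p => volume (dyadicCube p) ^ (2 / (n : ℝ) - 1)) A hA (f := fun x => ‖u x‖)
      hu.continuous.norm.measurable (by
        simpa [ofReal_norm] using setLIntegral_enorm_sq_ne_top μ hu.continuous hc hμP 1)
    simp only [ofReal_norm, ← hνP] at h3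
    calc _ ≤ _ := h1
      _ = 4 * ∑' j : ℕ, 2 ^ ((p₀.1 + j) * ((n : ℤ) - 2)) * ∫⁻ y, ν (near 0 (p₀.1 + j) y) ∂ν := by
        simp
      _ ≤ 4 * (8 * A * N) := by
        gcongr
        rw [hν, hP, ← h2]
        exact h3
      _ = _ := by ring
  -- Lying in the same dyadic cube is a symmetric relation, so the averaging operator can be moved
  -- from the gradient to `ν`.
  have hpair : ∀ j : ℕ, ∫⁻ x, (∫⁻ y in near 0 (p₀.1 + j) x, ‖fderiv ℝ u y‖ₑ) ∂ν =
      ∫⁻ y in P, ‖fderiv ℝ u y‖ₑ * ν (near 0 (p₀.1 + j) y) := fun j => by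
    set S : Set (Euc n × Euc n) := {q | q.1 ∈ near 0 (p₀.1 + j) q.2}
    have hSm : MeasurableSet S := measurableSet_near_prod 0 _
    have h1 : ∀ x ∈ P, ∫⁻ y in near 0 (p₀.1 + j) x, ‖fderiv ℝ u y‖ₑ =
        ∫⁻ y in P, ‖fderiv ℝ u y‖ₑ * S.indicator 1 (x, y) := fun x hx => by
      rw [← lintegral_indicator (measurableSet_near _ _ _), ← lintegral_indicator hPm]
      refine lintegral_congr fun y => ?_
      by_cases hy : y ∈ near 0 (p₀.1 + j) x
      · have hyP : y ∈ P := near_zero_subset (by simp) hx hy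
        have hyS : (x, y) ∈ S := mem_near_comm.1 hy
        simp [hy, hyP, hyS]
      · have hyS : (x, y) ∉ S := fun h => hy (mem_near_comm.1 h)
        simp [hy, hyS, Set.indicator]
    have h2 : ∫⁻ x, (∫⁻ y in near 0 (p₀.1 + j) x, ‖fderiv ℝ u y‖ₑ) ∂ν =
        ∫⁻ x, (∫⁻ y in P, ‖fderiv ℝ u y‖ₑ * S.indicator 1 (x, y)) ∂ν :=
      setLIntegral_congr_fun hPm h1
    rw [h2, lintegral_lintegral_swap]
    · refine lintegral_congr fun y => ?_
      have hSy : Measurable fun x => S.indicator (1 : Euc n × Euc n → ℝ≥0∞) (x, y) :=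
        (measurable_one.indicator hSm).comp measurable_prodMk_right
      rw [lintegral_const_mul _ hSy, ← lintegral_indicator_one (measurableSet_near _ _ _)]
      rfl
    · exact ((hfm.comp measurable_snd).mul (measurable_one.indicator hSm)).aemeasurable
  have hmain : N ≤ a * (∫⁻ x in P, ‖u x‖ₑ ∂μ) + C * ∫⁻ y in P, ‖fderiv ℝ u y‖ₑ * V y := by
    have hm : ∀ j : ℕ, Measurable fun x => ∫⁻ y in near 0 (p₀.1 + j) x, ‖fderiv ℝ u y‖ₑ := fun j => by
      have := measurable_measure_near (volume.withDensity fun y : Euc n => ‖fderiv ℝ u y‖ₑ) 0 (p₀.1 + j)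
      simpa only [withDensity_apply _ (measurableSet_near _ _ _)] using this
    have hm' : ∀ j : ℕ, Measurable fun x => 2 ^ ((p₀.1 + j) * ((n : ℤ) - 1)) *
      ∫⁻ y in near 0 (p₀.1 + j) x, ‖fderiv ℝ u y‖ₑ := fun j => (hm j).const_mul _
    calc N ≤ ∫⁻ x in P, ‖u x‖ₑ * (a + ∑' j : ℕ, C * (2 ^ ((p₀.1 + j) * ((n : ℤ) - 1)) *
            ∫⁻ y in near 0 (p₀.1 + j) x, ‖fderiv ℝ u y‖ₑ)) ∂μ := by
          refine setLIntegral_mono' hPm fun x hx => ?_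
          rw [sq]
          gcongr
          exact enorm_le_cubeAvg_add_tsum hu hc hx
      _ = ∫⁻ x, (a + ∑' j : ℕ, C * (2 ^ ((p₀.1 + j) * ((n : ℤ) - 1)) *
            ∫⁻ y in near 0 (p₀.1 + j) x, ‖fderiv ℝ u y‖ₑ)) ∂ν :=
          (hνint _ (measurable_const.add (Measurable.tsum fun j => (hm' j).const_mul C))).symm
      _ = a * ν Set.univ + C * ∑' j : ℕ, 2 ^ ((p₀.1 + j) * ((n : ℤ) - 1)) *
            ∫⁻ x, (∫⁻ y in near 0 (p₀.1 + j) x, ‖fderiv ℝ u y‖ₑ) ∂ν := by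
          rw [lintegral_add_left measurable_const, lintegral_const]
          simp_rw [ENNReal.tsum_mul_left]
          rw [lintegral_const_mul _ (Measurable.tsum hm'), lintegral_tsum fun j => (hm' j).aemeasurable]
          simp_rw [lintegral_const_mul _ (hm _)]
      _ = _ := by
          congr 2
          · rw [hν, Measure.restrict_apply_univ, hP, hνP]
          · have e : ∀ y, ‖fderiv ℝ u y‖ₑ * V y = ∑' j : ℕ, 2 ^ ((p₀.1 + j) * ((n : ℤ) - 1)) *
                (‖fderiv ℝ u y‖ₑ * ν (near 0 (p₀.1 + j) y)) := fun y => by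
              rw [hV, ← ENNReal.tsum_mul_left]
              congr 1; funext j; ring
            simp_rw [e]
            have hm2 : ∀ j : ℕ, Measurable fun y => ‖fderiv ℝ u y‖ₑ * ν (near 0 (p₀.1 + j) y) :=
              fun j => hfm.mul (measurable_measure_near ν 0 _)
            rw [lintegral_tsum fun j => ((hm2 j).const_mul _).aemeasurable]
            simp_rw [lintegral_const_mul _ (hm2 _), hpair]
  have hX : (a * ∫⁻ x in P, ‖u x‖ₑ ∂μ) ^ 2 ≤ a ^ 2 * μ P * N := by
    rw [mul_pow, mul_assoc]
    gcongr
    have := lintegral_mul_sq_le (μ.restrict P) (f := fun _ => 1) measurable_const.aemeasurable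
      hgm.aemeasurable
    simpa using this
  have hY : (C * ∫⁻ y in P, ‖fderiv ℝ u y‖ₑ * V y) ^ 2 ≤ C ^ 2 * H * (32 * A * N) := by
    rw [mul_pow, mul_assoc]
    gcongr
    refine (lintegral_mul_sq_le _ hfm.aemeasurable hVm.aemeasurable).trans ?_
    gcongr
    exact (setLIntegral_le_lintegral _ _).trans henergy
  -- Both terms of `hmain`, squared, carry one factor `N`. It is finite because `u` is bounded and
  -- `μ P` is finite, so it can be cancelled.
  have hfin : N * N ≤ (4 * a ^ 2 * μ P + 128 * C ^ 2 * A * H) * N := by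
    calc N * N = N ^ 2 := (sq N).symm
      _ ≤ _ := pow_le_pow_left' hmain 2
      _ ≤ _ := ENNReal_add_sq_le _ _
      _ ≤ 4 * (a ^ 2 * μ P * N + C ^ 2 * H * (32 * A * N)) := by gcongr
      _ = _ := by ring
  by_cases hN0 : N = 0
  · rw [hN0]; exact zero_le
  · exact (ENNReal.mul_le_mul_iff_left hN0 hNtop).1 hfin

/-- The term `P = P₀` alone of the Carleson sum gives `|P|^(2/n-1) μ(P) ≤ A`. Hence the average
costs only the Lebesgue norm of `u`, with a constant that depends on the scale. -/
theorem cubeAvg_sq_mul_measure_le (hn : n ≠ 0) (μ : Measure (Euc n)) [IsLocallyFiniteMeasure μ]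
    (p : ℤ × (Fin n → ℤ)) (A : ℝ≥0∞) (hA : carlesonSum μ p ≤ A * μ (dyadicCube p))
    {u : Euc n → 𝕜} (hu : Continuous u) :
    ‖cubeAvg p u‖ₑ ^ 2 * μ (dyadicCube p) ≤
      A * 2 ^ (p.1 * 2) * ∫⁻ x in dyadicCube p, ‖u x‖ₑ ^ 2 := by
  have hμ := measure_dyadicCube_ne_top μ p
  have h1 : 2 ^ (p.1 * ((n : ℤ) - 2)) * μ (dyadicCube p) ≤ A := by
    by_cases h0 : μ (dyadicCube p) = 0
    · simp [h0]
    refine (ENNReal.mul_le_mul_iff_left h0 hμ).1 (le_trans ?_ hA)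
    rw [mul_assoc, ← sq, ← volume_dyadicCube_rpow hn]
    exact ENNReal.le_tsum (f := fun q : {q : ℤ × (Fin n → ℤ) // dyadicCube q ⊆ dyadicCube p} =>
      volume (dyadicCube q.1) ^ (2 / (n : ℝ) - 1) * μ (dyadicCube q.1) ^ 2) ⟨p, subset_rfl⟩
  calc _ ≤ 2 ^ (p.1 * n) * (∫⁻ x in dyadicCube p, ‖u x‖ₑ ^ 2) * μ (dyadicCube p) := by
        gcongr; exact enorm_cubeAvg_sq_le p hu
    _ = (2 ^ (p.1 * ((n : ℤ) - 2)) * 2 ^ (p.1 * 2)) * (∫⁻ x in dyadicCube p, ‖u x‖ₑ ^ 2) *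
          μ (dyadicCube p) := by
        rw [← two_zpow_add]; congr 3; ring
    _ = (2 ^ (p.1 * ((n : ℤ) - 2)) * μ (dyadicCube p)) * 2 ^ (p.1 * 2) *
          ∫⁻ x in dyadicCube p, ‖u x‖ₑ ^ 2 := by ring
    _ ≤ _ := by gcongr

theorem lintegral_eq_tsum_dyadicCube (μ : Measure (Euc n)) (k : ℤ) (f : Euc n → ℝ≥0∞) :
    ∫⁻ x, f x ∂μ = ∑' m : Fin n → ℤ, ∫⁻ x in dyadicCube (k, m), f x ∂μ := by
  rw [← lintegral_iUnion (fun m => measurableSet_dyadicCube (k, m)), ← setLIntegral_univ]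
  · congr 2
    refine (Set.eq_univ_of_forall fun x => Set.mem_iUnion.2 ⟨idx k x, ?_⟩).symm
    exact mem_dyadicCube_iff.2 rfl
  · intro m m' hmm'
    refine Set.disjoint_left.2 fun x hx hx' => hmm' ?_
    rw [mem_dyadicCube_iff] at hx hx'
    exact hx.symm.trans hx'

theorem normSq_le_of_carleson (hn : n ≠ 0) (μ : Measure (Euc n)) [IsLocallyFiniteMeasure μ]
    (k : ℤ) (A : ℝ≥0∞)
    (hA : ∀ q : ℤ × (Fin n → ℤ), k ≤ q.1 → carlesonSum μ q ≤ A * μ (dyadicCube q))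
    {u : Euc n → 𝕜} (hu : ContDiff ℝ 1 u) (hc : HasCompactSupport u) :
    normSq μ u ≤ 128 * (n * 2 ^ n) ^ 2 * A * gradSq u + 4 * A * 2 ^ (k * 2) * normSq volume u := by
  have hcube : ∀ m : Fin n → ℤ, ∫⁻ x in dyadicCube (k, m), ‖u x‖ₑ ^ 2 ∂μ ≤
      128 * (n * 2 ^ n) ^ 2 * A * (∫⁻ x in dyadicCube (k, m), ‖fderiv ℝ u x‖ₑ ^ 2) +
      4 * A * 2 ^ (k * 2) * ∫⁻ x in dyadicCube (k, m), ‖u x‖ₑ ^ 2 := fun m => by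
    refine (setLIntegral_sq_le_of_carleson hn μ (k, m) A
      (fun q hq => hA q (le_level_of_subset hn hq)) hu hc).trans ?_
    rw [add_comm]
    refine add_le_add le_rfl ?_
    have := cubeAvg_sq_mul_measure_le hn μ (k, m) A (hA _ le_rfl) hu.continuous
    calc _ = 4 * (‖cubeAvg (k, m) u‖ₑ ^ 2 * μ (dyadicCube (k, m))) := by ring
      _ ≤ _ := mul_le_mul_right this 4
      _ = _ := by ring
  calc normSq μ u = ∑' m : Fin n → ℤ, ∫⁻ x in dyadicCube (k, m), ‖u x‖ₑ ^ 2 ∂μ :=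
        lintegral_eq_tsum_dyadicCube μ k _
    _ ≤ ∑' m : Fin n → ℤ, _ := ENNReal.tsum_le_tsum hcube
    _ = 128 * (n * 2 ^ n) ^ 2 * A * (∫⁻ x, ‖fderiv ℝ u x‖ₑ ^ 2) +
          4 * A * 2 ^ (k * 2) * ∫⁻ x, ‖u x‖ₑ ^ 2 := by
        rw [ENNReal.tsum_add, ENNReal.tsum_mul_left, ENNReal.tsum_mul_left,
          ← lintegral_eq_tsum_dyadicCube, ← lintegral_eq_tsum_dyadicCube]
    _ ≤ _ := by
        unfold gradSq normSq
        gcongr with x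
        exact enorm_clm_sq_le _

theorem exists_two_zpow_lt (c : ℝ) {δ : ℝ} (hδ : 0 < δ) : ∃ k : ℤ, ∀ j ≥ k, c * 2 ^ (-j) < δ := by
  obtain ⟨m, hm⟩ := pow_unbounded_of_one_lt (c / δ) (one_lt_two (α := ℝ))
  refine ⟨m, fun j hj => ?_⟩
  have h1 : (2 : ℝ) ^ m ≤ 2 ^ j := by
    rw [← zpow_natCast]; exact zpow_le_zpow_right₀ one_le_two hj
  rw [zpow_neg, ← div_eq_mul_inv, div_lt_iff₀ (by positivity)]
  rw [div_lt_iff₀ hδ] at hm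
  nlinarith

/-- The Carleson condition on small dyadic cubes implies infinitesimal form boundedness. -/
theorem formBound_of_carleson (hn : n ≠ 0) (μ : Measure (Euc n)) [IsLocallyFiniteMeasure μ]
    (h : Tendsto (fun δ : ℝ => ⨆ (p₀ : ℤ × (Fin n → ℤ))
          (_ : Metric.diam (dyadicCube p₀) ≤ δ ∧ μ (dyadicCube p₀) ≠ 0),
            carlesonSum μ p₀ / μ (dyadicCube p₀)) (𝓝[>] 0) (𝓝 0)) :
    ∃ ε₀ : ℝ, 0 < ε₀ ∧ ∃ C : ℝ → ℝ, ∀ ε : ℝ, 0 < ε → ε < ε₀ → 0 < C ε ∧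
        ∀ u : 𝓓((⊤ : Opens (EuclideanSpace ℝ (Fin n))), 𝕜),
          normSq μ u ≤ ENNReal.ofReal ε * gradSq u + ENNReal.ofReal (C ε) * normSq volume u := by
  suffices H : ∀ ε : ℝ, 0 < ε → ∃ C : ℝ, 0 < C ∧
      ∀ u : 𝓓((⊤ : Opens (EuclideanSpace ℝ (Fin n))), 𝕜),
        normSq μ u ≤ ENNReal.ofReal ε * gradSq u + ENNReal.ofReal C * normSq volume u by
    choose! C hC using H
    exact ⟨1, one_pos, C, fun ε hε _ => hC ε hε⟩
  intro ε hε
  set B : ℝ≥0∞ := 128 * (n * 2 ^ n) ^ 2 with hB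
  have hB0 : B ≠ 0 := by simp [hB, hn]
  have hBtop : B ≠ ⊤ := by
    rw [hB]
    exact ENNReal.mul_ne_top (by norm_num) (ENNReal.pow_ne_top
      (ENNReal.mul_ne_top (by simp) (by simp)))
  -- Chosen so that the gradient coefficient `B * A` is exactly `ε`; the level `k` below then
  -- determines `C ε`.
  set A : ℝ≥0∞ := ENNReal.ofReal ε / B with hAdef
  have hA0 : 0 < A := ENNReal.div_pos (by simpa using hε) hBtop
  have hAtop : A ≠ ⊤ := ENNReal.div_ne_top ENNReal.ofReal_ne_top hB0
  obtain ⟨δ, hδ, hle⟩ := mem_nhdsGT_iff_exists_Ioc_subset.1 (h (Iic_mem_nhds hA0))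
  have hδ' : (0 : ℝ) < δ := hδ
  have hsup := hle ⟨hδ', le_rfl⟩
  simp only [Set.mem_preimage, Set.mem_Iic, iSup_le_iff] at hsup
  obtain ⟨k, hk⟩ := exists_two_zpow_lt n hδ'
  have hcar : ∀ q : ℤ × (Fin n → ℤ), k ≤ q.1 → carlesonSum μ q ≤ A * μ (dyadicCube q) :=
    fun q hq => by
      -- Null cubes are excluded from the supremum, but all terms of their Carleson sums vanish.
      by_cases h0 : μ (dyadicCube q) = 0
      · have : carlesonSum μ q = 0 := by
          refine ENNReal.tsum_eq_zero.2 fun p => ?_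
          simp [measure_mono_null p.2 h0]
        rw [this]; exact zero_le
      · have := hsup q ⟨(diam_dyadicCube_le q).trans (hk _ hq).le, h0⟩
        rwa [ENNReal.div_le_iff h0 (measure_dyadicCube_ne_top μ q)] at this
  have hCtop : 4 * A * 2 ^ (k * 2) ≠ ⊤ :=
    ENNReal.mul_ne_top (ENNReal.mul_ne_top (by norm_num) hAtop) (two_zpow_ne_top _)
  refine ⟨(4 * A * 2 ^ (k * 2)).toReal, ENNReal.toReal_pos ?_ hCtop, fun u => ?_⟩
  · exact mul_ne_zero (mul_ne_zero (by norm_num) hA0.ne') (two_zpow_ne_zero _)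
  · rw [ENNReal.ofReal_toReal hCtop]
    refine (normSq_le_of_carleson hn μ k A hcar (u.contDiff.of_le (by simp))
      u.hasCompactSupport).trans_eq ?_
    rw [← hB, hAdef, ENNReal.mul_div_cancel hB0 hBtop]

/-! ### Faber–Krahn inequality and functions of small energy. -/

theorem lintegral_fderiv_sq_le_gradSq (u : Euc n → 𝕜) :
    ∫⁻ x, ‖fderiv ℝ u x‖ₑ ^ 2 ≤ gradSq u :=
  lintegral_mono fun _ => enorm_clm_sq_le _

theorem gradSq_le (u : Euc n → 𝕜) : gradSq u ≤ n * ∫⁻ x, ‖fderiv ℝ u x‖ₑ ^ 2 := by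
  rw [← lintegral_const_mul' _ _ (by simp)]
  exact lintegral_mono fun _ => sum_enorm_clm_sq_le _

theorem lintegral_enorm_sq_ne_top {F : Type*} [NormedAddCommGroup F] (μ : Measure (Euc n))
    [IsLocallyFiniteMeasure μ] {u : Euc n → F} (hu : Continuous u) (hc : HasCompactSupport u) :
    ∫⁻ x, ‖u x‖ₑ ^ 2 ∂μ ≠ ⊤ := by
  have h := setLIntegral_enorm_sq_ne_top μ hu hc (P := tsupport u) hc.isCompact.measure_lt_top.ne 2
  rwa [setLIntegral_eq_of_support_subset] at h
  refine (Function.support_subset_iff'.2 fun x hx => ?_)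
  simp [image_eq_zero_of_notMem_tsupport hx]

/-- A Faber–Krahn type inequality. -/
theorem exists_faberKrahn (hn : 2 ≤ n) : ∃ K : ℝ≥0∞, K ≠ ⊤ ∧ ∀ v : Euc n → ℝ, ContDiff ℝ 1 v →
    HasCompactSupport v → normSq volume v ≤
      K * volume {x | v x ≠ 0} ^ (2 / (n : ℝ)) * ∫⁻ x, ‖fderiv ℝ v x‖ₑ ^ 2 := by
  have hn1 : (1 : ℝ) < n := by exact_mod_cast (by omega : 1 < n)
  set p : ℝ := (n : ℝ).conjExponent
  have hp : (n : ℝ).HolderConjugate p := Real.HolderConjugate.conjExponent hn1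
  have hp0 : p ≠ 0 := hp.symm.ne_zero
  have hp' : (Module.finrank ℝ (Euc n) : ℝ).HolderConjugate p := by
    rwa [finrank_euclideanSpace_fin]
  set C : ℝ≥0∞ := (lintegralPowLePowLIntegralFDerivConst (volume : Measure (Euc n)) p : ℝ≥0∞)
    with hC
  refine ⟨(C ^ (1 / p) * 2) ^ 2, ?_, fun v hv hc => ?_⟩
  · refine ENNReal.pow_ne_top (ENNReal.mul_ne_top
      (ENNReal.rpow_ne_top_of_nonneg ?_ (by simp [hC])) (by simp))
    exact (one_div_pos.2 hp.symm.pos).le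
  set V := normSq volume v with hV
  set D := ∫⁻ x, ‖fderiv ℝ v x‖ₑ ^ 2 with hD
  set S : Set (Euc n) := {x | v x ≠ 0} with hS
  set I := ∫⁻ x, ‖v x‖ₑ * ‖fderiv ℝ v x‖ₑ with hI
  have hSm : MeasurableSet S := (isOpen_ne_fun hv.continuous continuous_const).measurableSet
  have hvm : Measurable fun x => ‖v x‖ₑ := (continuous_enorm.comp hv.continuous).measurable
  have hdm : Measurable fun x => ‖fderiv ℝ v x‖ₑ :=
    (continuous_enorm.comp (hv.continuous_fderiv one_ne_zero)).measurable
  -- The `L¹` Sobolev inequality is applied to `v²`, with target exponent `n / (n - 1)`; unlike the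
  -- `L²` version it also covers `n = 2`. Hölder on the support of `v` and Cauchy–Schwarz for `∫ |v|
  -- |∇v|` then give a bound for `V²` with a factor `V` to cancel.
  have hgns := lintegral_pow_le_pow_lintegral_fderiv (volume : Measure (Euc n))
    (u := fun x => v x ^ 2) (hv.pow 2) (hc.comp_left (g := fun t : ℝ => t ^ 2) (by simp)) hp'
  have hder : ∫⁻ x, ‖fderiv ℝ (fun x => v x ^ 2) x‖ₑ ≤ 2 * I := by
    have hm : Measurable fun x => ‖v x‖ₑ * ‖fderiv ℝ v x‖ₑ := hvm.mul hdm
    rw [hI, ← lintegral_const_mul _ hm]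
    refine lintegral_mono fun x => ?_
    rw [fderiv_fun_pow 2 (hv.differentiable one_ne_zero x), enorm_smul]
    simp [enorm_mul, mul_assoc, Real.enorm_eq_ofReal_abs]
  have hvw : ∀ x, ‖v x ^ 2‖ₑ = ‖v x‖ₑ ^ 2 := fun x => by rw [enorm_pow]
  have hholder : V ≤ (∫⁻ x, ‖v x ^ 2‖ₑ ^ p) ^ (1 / p) * volume S ^ (1 / (n : ℝ)) := by
    have h := ENNReal.lintegral_mul_le_Lp_mul_Lq (volume : Measure (Euc n)) hp.symm
      (f := fun x => ‖v x ^ 2‖ₑ) (g := S.indicator 1) (by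
        simp_rw [hvw]; exact (hvm.pow_const 2).aemeasurable)
      (measurable_one.indicator hSm).aemeasurable
    have h1 : ∀ x, S.indicator (1 : Euc n → ℝ≥0∞) x ^ (n : ℝ) = S.indicator 1 x := fun x => by
      by_cases hx : x ∈ S
      · simp [hx]
      · simp [hx]; omega
    simp_rw [h1] at h
    rw [lintegral_indicator_one hSm] at h
    refine le_trans (lintegral_mono fun x => ?_) h
    by_cases hx : x ∈ S
    · simp [hx, hvw]
    · simp [hx, not_not.1 hx]
  have h2 : V ≤ C ^ (1 / p) * (2 * I) * volume S ^ (1 / (n : ℝ)) := by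
    refine hholder.trans ?_
    gcongr
    calc _ ≤ (C * (2 * I) ^ p) ^ (1 / p) := by
          refine ENNReal.rpow_le_rpow (hgns.trans ?_) (one_div_pos.2 hp.symm.pos).le
          gcongr
          exact hp.symm.pos.le
      _ = _ := by
          rw [ENNReal.mul_rpow_of_nonneg _ _ (one_div_pos.2 hp.symm.pos).le, ← ENNReal.rpow_mul,
            mul_one_div_cancel hp0, ENNReal.rpow_one]
  have hI2 : I ^ 2 ≤ V * D := lintegral_mul_sq_le _ hvm.aemeasurable hdm.aemeasurable
  have hfin : V * V ≤ ((C ^ (1 / p) * 2) ^ 2 * volume S ^ (2 / (n : ℝ)) * D) * V := by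
    calc V * V = V ^ 2 := (sq V).symm
      _ ≤ _ := pow_le_pow_left' h2 2
      _ = (C ^ (1 / p) * 2) ^ 2 * I ^ 2 * (volume S ^ (1 / (n : ℝ))) ^ 2 := by ring
      _ = (C ^ (1 / p) * 2) ^ 2 * I ^ 2 * volume S ^ (2 / (n : ℝ)) := by
          rw [← ENNReal.rpow_natCast (volume S ^ _), ← ENNReal.rpow_mul]
          congr 2; push_cast; ring
      _ ≤ (C ^ (1 / p) * 2) ^ 2 * (V * D) * volume S ^ (2 / (n : ℝ)) := by gcongr
      _ = _ := by ring
  by_cases hV0 : V = 0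
  · rw [hV0]; exact zero_le
  · exact (ENNReal.mul_le_mul_iff_left hV0 (lintegral_enorm_sq_ne_top volume hv.continuous hc)).1 hfin

theorem exists_faberKrahn_small (hn : 2 ≤ n) {τ : ℝ≥0∞} (hτ : 0 < τ) : ∃ η : ℝ≥0∞, 0 < η ∧
    ∀ v : Euc n → ℝ, ContDiff ℝ 1 v → HasCompactSupport v → volume {x | v x ≠ 0} ≤ η →
      normSq volume v ≤ τ * ∫⁻ x, ‖fderiv ℝ v x‖ₑ ^ 2 := by
  obtain ⟨K, hK, h⟩ := exists_faberKrahn hn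
  have hn0 : (0 : ℝ) < n := by exact_mod_cast (by omega : 0 < n)
  refine ⟨(τ / (K + 1)) ^ ((n : ℝ) / 2), ?_, fun v hv hc hvol => (h v hv hc).trans ?_⟩
  · exact ENNReal.rpow_pos_of_nonneg (ENNReal.div_pos hτ.ne' (by simp [hK])) (by positivity)
  · gcongr
    calc K * volume {x | v x ≠ 0} ^ (2 / (n : ℝ))
        ≤ (K + 1) * ((τ / (K + 1)) ^ ((n : ℝ) / 2)) ^ (2 / (n : ℝ)) := by
          gcongr
          exact le_self_add
      _ = (K + 1) * (τ / (K + 1)) := by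
          rw [← ENNReal.rpow_mul, show (n : ℝ) / 2 * (2 / n) = 1 by field_simp, ENNReal.rpow_one]
      _ ≤ τ := ENNReal.mul_div_le

theorem sum_enorm_sq_of_subsingleton {ι E : Type*} [NormedAddCommGroup E] (s : Finset ι)
    (c : ι → E) (h : ∀ i ∈ s, ∀ j ∈ s, c i ≠ 0 → c j ≠ 0 → i = j) :
    ‖∑ i ∈ s, c i‖ₑ ^ 2 ≤ ∑ i ∈ s, ‖c i‖ₑ ^ 2 := by
  by_cases hs : ∃ i ∈ s, c i ≠ 0
  · obtain ⟨i, hi, hci⟩ := hs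
    rw [Finset.sum_eq_single_of_mem i hi fun j hj hji => by
      by_contra hcj; exact hji (h j hj i hi hcj hci)]
    exact Finset.single_le_sum (f := fun i => ‖c i‖ₑ ^ 2) (fun _ _ => zero_le) hi
  · push Not at hs
    simp [Finset.sum_eq_zero hs]

theorem lintegral_comp_two_pow_smul (f : Euc n → ℝ≥0∞) (k : ℕ) :
    ∫⁻ x, f ((2 : ℝ) ^ k • x) = 2 ^ (-(k : ℤ) * n) * ∫⁻ y, f y := by
  have h : ∀ x : Euc n, f ((2 : ℝ) ^ k • x) = f (0 + (2 : ℝ) ^ k • x) := fun x => by rw [zero_add]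
  rw [lintegral_congr h, lintegral_comp_add_smul f 0 (by positivity), ← ofReal_two_zpow, zpow_mul,
    zpow_natCast, zpow_neg, zpow_natCast, inv_pow]

/-- Points have zero capacity: small balls carry test functions of small energy. -/
theorem exists_small_energy (hn : 2 ≤ n) {η : ℝ≥0∞} (hη : 0 < η) : ∃ r : ℝ, 0 < r ∧
    ∃ v : Euc n → ℝ, ContDiff ℝ (⊤ : ℕ∞) v ∧ HasCompactSupport v ∧ (∀ x, ‖x‖ ≤ r → 1 < v x) ∧
      gradSq v + normSq volume v ≤ η := by
  set b : ContDiffBump (0 : Euc n) := ⟨1, 2, by norm_num, by norm_num⟩ with hb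
  have hbs : ContDiff ℝ (⊤ : ℕ∞) b := b.contDiff
  set D := ∫⁻ x, ‖fderiv ℝ b x‖ₑ ^ 2 with hD
  set V := ∫⁻ x, ‖b x‖ₑ ^ 2 with hV
  have hbd : Measurable fun x => ‖fderiv ℝ b x‖ₑ ^ 2 :=
    ((continuous_enorm.comp (hbs.continuous_fderiv (by simp))).measurable).pow_const 2
  have hbv : Measurable fun x => ‖b x‖ₑ ^ 2 :=
    ((continuous_enorm.comp hbs.continuous).measurable).pow_const 2
  have hVtop : V ≠ ⊤ := lintegral_enorm_sq_ne_top volume hbs.continuous b.hasCompactSupport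
  have hDtop : D ≠ ⊤ := lintegral_enorm_sq_ne_top volume (hbs.continuous_fderiv (by simp))
    (b.hasCompactSupport.fderiv ℝ)
  -- The energy of the function `v` built below is at most `K / N`.
  set K : ℝ≥0∞ := n * (4 * D) + 8 * V with hK
  have hKtop : K ≠ ⊤ := by simp [hK, ENNReal.mul_eq_top, hDtop, hVtop]
  obtain ⟨N, hN⟩ := ENNReal.exists_nat_gt (ENNReal.div_ne_top hKtop hη.ne')
  have hN0 : N ≠ 0 := fun h => by simp [h] at hN
  have hN0' : (N : ℝ≥0∞) ≠ 0 := by exact_mod_cast hN0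
  have hNt : (N : ℝ≥0∞) ≠ ⊤ := by simp
  have hNr : (0 : ℝ) < N := by exact_mod_cast Nat.pos_of_ne_zero hN0
  set c : ℝ := 2 / N with hc
  have hcE : ‖c‖ₑ = 2 / N := by
    rw [hc, Real.enorm_of_nonneg (by positivity), ENNReal.ofReal_div_of_pos hNr]; simp
  have hcE2 : ‖c‖ₑ ^ 2 * N = 4 / N := by
    rw [hcE, ENNReal.div_eq_inv_mul, ENNReal.div_eq_inv_mul]
    calc _ = (N : ℝ≥0∞)⁻¹ * ((N : ℝ≥0∞)⁻¹ * N) * 4 := by ring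
      _ = _ := by rw [ENNReal.inv_mul_cancel hN0' hNt, mul_one]
  -- A discrete logarithm: `N` dyadic rescalings of a bump with weight `2 / N` add up to 2 near the
  -- origin. Their gradients live on disjoint annuli and, as `n ≥ 2`, no rescaling increases the
  -- Dirichlet integral, so the total is at most `N (2/N)² D`.
  set v : Euc n → ℝ := fun x => ∑ k ∈ Finset.range N, c * b ((2 : ℝ) ^ k • x) with hv
  have hder : ∀ x, HasFDerivAt v
      (∑ k ∈ Finset.range N, (c * 2 ^ k) • fderiv ℝ b ((2 : ℝ) ^ k • x)) x := fun x => by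
    refine HasFDerivAt.fun_sum fun k _ => ?_
    have h1 : HasFDerivAt (fun x : Euc n => (2 : ℝ) ^ k • x)
        ((2 : ℝ) ^ k • ContinuousLinearMap.id ℝ (Euc n)) x :=
      (hasFDerivAt_id x).fun_const_smul _
    have h2 := ((hbs.differentiable (by simp) ((2 : ℝ) ^ k • x)).hasFDerivAt.comp x h1).const_mul c
    refine h2.congr_fderiv ?_
    ext y; simp; ring
  -- Where the bump attains its maximum 1 or its minimum 0 the derivative vanishes, the two bounding
  -- spheres included. The strict inequalities make the rescaled annuli disjoint.
  have hne : ∀ y : Euc n, fderiv ℝ b y ≠ 0 → 1 < ‖y‖ ∧ ‖y‖ < 2 := fun y hy => by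
    constructor
    · by_contra h
      refine hy (IsLocalMax.fderiv_eq_zero (Eventually.of_forall fun z => ?_))
      rw [b.one_of_mem_closedBall (x := y) (by simpa [hb] using h)]
      exact b.le_one
    · by_contra h
      refine hy (IsLocalMin.fderiv_eq_zero (Eventually.of_forall fun z => ?_))
      rw [b.zero_of_le_dist (x := y) (by simpa [hb] using h)]
      exact b.nonneg
  refine ⟨(2 ^ N)⁻¹, by positivity, v, ?_, ?_, ?_, ?_⟩
  · refine ContDiff.sum fun k _ => contDiff_const.mul (hbs.comp ?_)
    fun_prop
  · refine HasCompactSupport.of_support_subset_isCompact (isCompact_closedBall (0 : Euc n) 2) ?_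
    intro x hx
    by_contra hx2
    refine hx (Finset.sum_eq_zero fun k _ => ?_)
    have hx2' : 2 < ‖x‖ := by simpa using hx2
    have h1 : (1 : ℝ) ≤ 2 ^ k := one_le_pow₀ (by norm_num)
    rw [b.zero_of_le_dist, mul_zero]
    rw [dist_zero_right, norm_smul, Real.norm_of_nonneg (by positivity)]
    change (2 : ℝ) ≤ _
    nlinarith
  · intro x hx
    have h1 : v x = ∑ k ∈ Finset.range N, c := by
      refine Finset.sum_congr rfl fun k hk => ?_
      rw [b.one_of_mem_closedBall, mul_one]
      rw [mem_closedBall_zero_iff, norm_smul, Real.norm_of_nonneg (by positivity)]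
      change _ ≤ (1 : ℝ)
      have h2 : (2 : ℝ) ^ k ≤ 2 ^ N :=
        pow_le_pow_right₀ (by norm_num) (Finset.mem_range.1 hk).le
      calc (2 : ℝ) ^ k * ‖x‖ ≤ 2 ^ N * (2 ^ N)⁻¹ := by gcongr
        _ = 1 := mul_inv_cancel₀ (by positivity)
    rw [h1, Finset.sum_const, Finset.card_range, nsmul_eq_mul, hc, mul_div_cancel₀ _ hNr.ne']
    norm_num
  · have hgrad : ∫⁻ x, ‖fderiv ℝ v x‖ₑ ^ 2 ≤ 4 / N * D := by
      calc ∫⁻ x, ‖fderiv ℝ v x‖ₑ ^ 2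
          ≤ ∫⁻ x, ∑ k ∈ Finset.range N, (‖c‖ₑ ^ 2 * 2 ^ ((k : ℤ) * 2)) *
              ‖fderiv ℝ b ((2 : ℝ) ^ k • x)‖ₑ ^ 2 := by
            refine lintegral_mono fun x => ?_
            rw [(hder x).fderiv]
            refine (sum_enorm_sq_of_subsingleton _ _ fun i _ j _ hi hj => ?_).trans_eq ?_
            · have hi' := hne _ (right_ne_zero_of_smul hi)
              have hj' := hne _ (right_ne_zero_of_smul hj)
              rw [norm_smul, Real.norm_of_nonneg (by positivity)] at hi' hj'
              have key : ∀ i j : ℕ, (1 < (2 : ℝ) ^ i * ‖x‖) → ((2 : ℝ) ^ j * ‖x‖ < 2) → j ≤ i := by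
                intro i j h1 h2
                by_contra hlt
                have h3 : (2 : ℝ) ^ (i + 1) ≤ 2 ^ j := pow_le_pow_right₀ (by norm_num) (by omega)
                have h4 : (2 : ℝ) ^ (i + 1) * ‖x‖ ≤ 2 ^ j * ‖x‖ := by gcongr
                rw [pow_succ] at h4
                linarith
              exact le_antisymm (key j i hj'.1 hi'.2) (key i j hi'.1 hj'.2)
            · refine Finset.sum_congr rfl fun k _ => ?_
              rw [enorm_smul, enorm_mul, mul_pow, mul_pow,
                show (k : ℤ) * 2 = (k : ℤ) * ((2 : ℕ) : ℤ) by norm_num, two_zpow_mul_natCast, zpow_natCast,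
                Real.enorm_of_nonneg (show (0 : ℝ) ≤ 2 ^ k by positivity),
                ENNReal.ofReal_pow (by norm_num)]
              simp
        _ = ∑ k ∈ Finset.range N, (‖c‖ₑ ^ 2 * 2 ^ ((k : ℤ) * 2)) * (2 ^ (-(k : ℤ) * n) * D) := by
            have hm : ∀ k : ℕ, Measurable fun x : Euc n => ‖fderiv ℝ b ((2 : ℝ) ^ k • x)‖ₑ ^ 2 :=
              fun k => hbd.comp (by fun_prop)
            rw [lintegral_finsetSum _ fun k _ => (hm k).const_mul _]
            refine Finset.sum_congr rfl fun k _ => ?_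
            rw [lintegral_const_mul _ (hm k),
              lintegral_comp_two_pow_smul (fun y => ‖fderiv ℝ b y‖ₑ ^ 2) k]
        _ ≤ ∑ k ∈ Finset.range N, ‖c‖ₑ ^ 2 * D := by
            refine Finset.sum_le_sum fun k _ => ?_
            calc _ = ‖c‖ₑ ^ 2 * (2 ^ ((k : ℤ) * 2) * 2 ^ (-(k : ℤ) * n)) * D := by ring
              _ ≤ ‖c‖ₑ ^ 2 * 1 * D := by
                gcongr
                rw [← two_zpow_add, ← ofReal_two_zpow]
                refine ENNReal.ofReal_le_one.2 (zpow_le_one_of_nonpos₀ one_le_two ?_)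
                have : (2 : ℤ) ≤ n := by exact_mod_cast hn
                nlinarith
              _ = _ := by ring
        _ = _ := by
            rw [Finset.sum_const, Finset.card_range, nsmul_eq_mul, ← hcE2]; ring
    have hval : normSq volume v ≤ 8 / N * V := by
      calc ∫⁻ x, ‖v x‖ₑ ^ 2
          ≤ ∫⁻ x, (‖c‖ₑ ^ 2 * N) * ∑ k ∈ Finset.range N, ‖b ((2 : ℝ) ^ k • x)‖ₑ ^ 2 := by
            refine lintegral_mono fun x => ?_
            have h1 : v x ^ 2 ≤ c ^ 2 * N * ∑ k ∈ Finset.range N, b ((2 : ℝ) ^ k • x) ^ 2 := by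
              have h := sq_sum_le_card_mul_sum_sq (s := Finset.range N)
                (f := fun k => b ((2 : ℝ) ^ k • x))
              rw [Finset.card_range] at h
              simp only [hv]
              rw [← Finset.mul_sum, mul_pow, mul_assoc]
              gcongr
            have h2 : ∀ t : ℝ, ‖t‖ₑ ^ 2 = ENNReal.ofReal (t ^ 2) := fun t => by
              rw [← enorm_pow, Real.enorm_of_nonneg (sq_nonneg t)]
            simp_rw [h2]
            rw [← ENNReal.ofReal_sum_of_nonneg fun _ _ => sq_nonneg _, ← ENNReal.ofReal_natCast,
              ← ENNReal.ofReal_mul (sq_nonneg _), ← ENNReal.ofReal_mul (by positivity)]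
            exact ENNReal.ofReal_le_ofReal h1
        _ = (‖c‖ₑ ^ 2 * N) * ∑ k ∈ Finset.range N, 2 ^ (-(k : ℤ) * n) * V := by
            have hm : ∀ k : ℕ, Measurable fun x : Euc n => ‖b ((2 : ℝ) ^ k • x)‖ₑ ^ 2 :=
              fun k => hbv.comp (by fun_prop)
            rw [lintegral_const_mul _ (Finset.measurable_fun_sum _ fun k _ => hm k),
              lintegral_finsetSum _ fun k _ => hm k]
            congr 1
            refine Finset.sum_congr rfl fun k _ => ?_
            rw [lintegral_comp_two_pow_smul (fun y => ‖b y‖ₑ ^ 2) k]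
        _ ≤ (‖c‖ₑ ^ 2 * N) * ∑ k ∈ Finset.range N, 2 ^ (-(k : ℤ)) * V := by
            refine mul_le_mul_right (Finset.sum_le_sum fun k _ => mul_le_mul_left ?_ V) _
            rw [← ofReal_two_zpow, ← ofReal_two_zpow]
            refine ENNReal.ofReal_le_ofReal (zpow_le_zpow_right₀ one_le_two ?_)
            have : (2 : ℤ) ≤ n := by exact_mod_cast hn
            nlinarith
        _ ≤ (‖c‖ₑ ^ 2 * N) * (2 * V) := by
            rw [← Finset.sum_mul]
            gcongr
            exact (ENNReal.sum_le_tsum _).trans_eq tsum_two_zpow_neg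
        _ = _ := by
            rw [hcE2, ENNReal.div_eq_inv_mul, ENNReal.div_eq_inv_mul]; ring
    calc gradSq v + normSq volume v ≤ n * (4 / N * D) + 8 / N * V := by
          gcongr
          exact (gradSq_le v).trans (by gcongr)
      _ = K / N := by
          rw [hK]; simp only [ENNReal.div_eq_inv_mul]; ring
      _ ≤ η := by
          rw [ENNReal.div_le_iff hN0' hNt, mul_comm,
            ← ENNReal.div_le_iff_le_mul (Or.inl hη.ne') (Or.inr hN0')]
          exact hN.le

/-! ### Capacity, and the capacitary condition from form boundedness. -/

theorem exists_smooth_step : ∃ ψ : ℝ → ℝ, ∃ L : ℝ, 0 ≤ L ∧ ContDiff ℝ (⊤ : ℕ∞) ψ ∧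
    (∀ t ≤ 1 / 2, ψ t = 0) ∧ (∀ t, 1 ≤ t → ψ t = 1) ∧ (∀ t, |deriv ψ t| ≤ L) ∧
      ∀ t, deriv ψ t ≠ 0 → 1 / 2 ≤ t ∧ t ≤ 1 := by
  set ψ : ℝ → ℝ := fun t => Real.smoothTransition (2 * t - 1) with hψ
  have hs : ContDiff ℝ (⊤ : ℕ∞) ψ := Real.smoothTransition.contDiff.comp (by fun_prop)
  have h0 : ∀ t ≤ 1 / 2, ψ t = 0 := fun t ht =>
    Real.smoothTransition.zero_of_nonpos (by linarith)
  have h1 : ∀ t, 1 ≤ t → ψ t = 1 := fun t ht => Real.smoothTransition.one_of_one_le (by linarith)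
  have hd : ∀ t, deriv ψ t ≠ 0 → 1 / 2 ≤ t ∧ t ≤ 1 := fun t ht => by
    constructor
    · by_contra h
      refine ht (IsLocalMin.deriv_eq_zero (Eventually.of_forall fun s => ?_))
      rw [h0 t (by linarith)]
      exact Real.smoothTransition.nonneg _
    · by_contra h
      refine ht (IsLocalMax.deriv_eq_zero (Eventually.of_forall fun s => ?_))
      rw [h1 t (by linarith)]
      exact Real.smoothTransition.le_one _
  obtain ⟨L, hL⟩ := (isCompact_Icc (a := (1 / 2 : ℝ)) (b := 1)).exists_bound_of_continuousOn
    (hs.continuous_deriv (by simp)).continuousOn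
  refine ⟨ψ, max L 0, le_max_right _ _, hs, h0, h1, fun t => ?_, hd⟩
  by_cases ht : deriv ψ t = 0
  · simp [ht]
  · exact (hL t (hd t ht)).trans (le_max_left _ _)

theorem cap_le {e : Set (Euc n)} {v : Euc n → ℝ} (hv : ContDiff ℝ (⊤ : ℕ∞) v)
    (hc : HasCompactSupport v) (h : ∀ x ∈ e, 1 < v x) : cap e ≤ gradSq v + normSq volume v :=
  iInf₂_le (f := fun (u : 𝓓((⊤ : Opens (Euc n)), ℝ)) (_ : ∀ x ∈ e, 1 < u x) =>
    gradSq u + normSq volume u) ⟨v, hv, hc, by simp⟩ h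

/-- A source of sets of positive capacity: positive volume suffices. -/
theorem volume_le_cap {e : Set (Euc n)} (he : MeasurableSet e) : volume e ≤ cap e := by
  refine le_iInf₂ fun u hu => le_add_left ?_
  rw [← setLIntegral_one e, ← lintegral_indicator he]
  refine lintegral_mono fun x => ?_
  by_cases hx : x ∈ e
  · simp only [hx, Set.indicator_of_mem]
    have : (1 : ℝ≥0∞) ≤ ‖u x‖ₑ := by
      rw [Real.enorm_eq_ofReal_abs, ENNReal.one_le_ofReal]
      exact (hu x hx).le.trans (le_abs_self _)
    exact one_le_pow_of_one_le' this 2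
  · simp [hx]

/-- A capacitary bound passes to all compact sets, also those of zero capacity. -/
theorem measure_le_of_cap {μ : Measure (Euc n)} {ω : ℝ≥0∞} (hω : ω ≠ 0) {δ : ℝ}
    (hμ : ∀ e : Set (Euc n), IsCompact e → Metric.diam e ≤ δ → 0 < cap e → μ e / cap e ≤ ω)
    {e : Set (Euc n)} (he : IsCompact e) {x₀ : Euc n} {ρ : ℝ} (hρ : 0 ≤ ρ) (hρδ : 2 * ρ ≤ δ)
    (hball : e ⊆ Metric.ball x₀ ρ) {v : Euc n → ℝ} (hv : ContDiff ℝ (⊤ : ℕ∞) v)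
    (hc : HasCompactSupport v) (h : ∀ x ∈ e, 1 < v x) :
    μ e ≤ ω * (gradSq v + normSq volume v) := by
  rcases e.eq_empty_or_nonempty with rfl | ⟨y, hy⟩
  · simp
  -- The set is thickened inside `{1 < v}` and the ball: the thickening contains a ball, so it has
  -- positive capacity, and `v` remains admissible for it.
  obtain ⟨s, hs, hsub⟩ := he.exists_cthickening_subset_open
    ((isOpen_lt continuous_const hv.continuous).inter Metric.isOpen_ball)
    (fun x hx => ⟨h x hx, hball hx⟩ : e ⊆ {x | 1 < v x} ∩ Metric.ball x₀ ρ)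
  set E := Metric.cthickening s e
  have hE : IsCompact E := he.cthickening
  have hdiam : Metric.diam E ≤ δ :=
    ((Metric.diam_mono (hsub.trans Set.inter_subset_right) Metric.isBounded_ball).trans
      (Metric.diam_ball hρ)).trans hρδ
  have hcap : 0 < cap E := by
    refine lt_of_lt_of_le ?_ (volume_le_cap hE.measurableSet)
    refine (Metric.measure_ball_pos volume y hs).trans_le (measure_mono ?_)
    exact Metric.ball_subset_closedBall.trans (Metric.closedBall_subset_cthickening hy s)
  calc μ e ≤ μ E := measure_mono (Metric.self_subset_cthickening e)
    _ ≤ ω * cap E := by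
        rw [← ENNReal.div_le_iff_le_mul (Or.inl hcap.ne') (Or.inr hω)]
        exact hμ E hE hdiam hcap
    _ ≤ _ := by
        gcongr
        exact cap_le hv hc fun x hx => (hsub hx).1

theorem enorm_fderiv_ofReal_le {v : Euc n → ℝ} (hv : Differentiable ℝ v) (x : Euc n) :
    ‖fderiv ℝ (fun x => (v x : 𝕜)) x‖ₑ ≤ ‖fderiv ℝ v x‖ₑ := by
  have h : HasFDerivAt (fun x => (v x : 𝕜)) ((RCLike.ofRealCLM (K := 𝕜)).comp (fderiv ℝ v x)) x :=
    (RCLike.ofRealCLM (K := 𝕜)).hasFDerivAt.comp x (hv x).hasFDerivAt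
  rw [h.fderiv, ← ofReal_norm, ← ofReal_norm]
  refine ENNReal.ofReal_le_ofReal (ContinuousLinearMap.opNorm_le_bound _ (norm_nonneg _) fun y => ?_)
  simpa using (fderiv ℝ v x).le_opNorm y

theorem gradSq_ofReal_le {v : Euc n → ℝ} (hv : Differentiable ℝ v) :
    gradSq (fun x => (v x : 𝕜)) ≤ n * ∫⁻ x, ‖fderiv ℝ v x‖ₑ ^ 2 := by
  refine (gradSq_le _).trans ?_
  gcongr with x
  exact enorm_fderiv_ofReal_le hv x

theorem normSq_ofReal (μ : Measure (Euc n)) (v : Euc n → ℝ) :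
    normSq μ (fun x => (v x : 𝕜)) = normSq μ v := by
  refine lintegral_congr fun x => ?_
  rw [← ofReal_norm, ← ofReal_norm, RCLike.norm_ofReal, Real.norm_eq_abs]

theorem contDiff_ofReal {v : Euc n → ℝ} {m : WithTop ℕ∞} (hv : ContDiff ℝ m v) :
    ContDiff ℝ m fun x => (v x : 𝕜) :=
  (RCLike.ofRealCLM (K := 𝕜)).contDiff.comp hv

theorem hasCompactSupport_ofReal {v : Euc n → ℝ} (hc : HasCompactSupport v) :
    HasCompactSupport fun x => (v x : 𝕜) :=
  hc.comp_left (g := fun t : ℝ => (t : 𝕜)) (by simp)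

theorem exists_pos_mul_le {K ε : ℝ≥0∞} (hK : K ≠ ⊤) (hε : 0 < ε) :
    ∃ τ : ℝ≥0∞, 0 < τ ∧ K * τ ≤ ε := by
  refine ⟨ε / (K + 1), ENNReal.div_pos hε.ne' (by simp [hK]), ?_⟩
  calc K * (ε / (K + 1)) ≤ (K + 1) * (ε / (K + 1)) := by gcongr; exact le_self_add
    _ ≤ ε := ENNReal.mul_div_le

/-- Infinitesimal form boundedness implies the capacitary condition on small compact sets. -/
theorem capacity_of_formBound (hn : 2 ≤ n) (μ : Measure (Euc n))
    (h : ∃ ε₀ : ℝ, 0 < ε₀ ∧ ∃ C : ℝ → ℝ, ∀ ε : ℝ, 0 < ε → ε < ε₀ → 0 < C ε ∧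
        ∀ u : 𝓓((⊤ : Opens (EuclideanSpace ℝ (Fin n))), 𝕜),
          normSq μ u ≤ ENNReal.ofReal ε * gradSq u + ENNReal.ofReal (C ε) * normSq volume u) :
    Tendsto (fun δ : ℝ => ⨆ (e : Set (EuclideanSpace ℝ (Fin n)))
          (_ : IsCompact e ∧ Metric.diam e ≤ δ ∧ 0 < cap e), μ e / cap e) (𝓝[>] 0) (𝓝 0) := by
  obtain ⟨ε₀, hε₀, C, hC⟩ := h
  obtain ⟨ψ, L, hL0, hψs, hψ0, hψ1, hψL, -⟩ := exists_smooth_step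
  rw [ENNReal.tendsto_nhds_zero]
  intro ε hε
  have hε2 : 0 < ε / 2 := ENNReal.div_pos hε.ne' (by simp)
  set ℓ : ℝ≥0∞ := ENNReal.ofReal L ^ 2 with hℓ
  have hℓt : ℓ ≠ ⊤ := by simp [hℓ]
  obtain ⟨t, ht0, ht⟩ := exists_pos_mul_le (K := n * ℓ) (ENNReal.mul_ne_top (by simp) hℓt) hε2
  -- Half of `ε` pays for the gradient term of the form bound. The other half pays for the `L²`
  -- term, through the Faber–Krahn constant `τ` chosen after `C ε₁`.
  obtain ⟨ε₁, hε₁, hε₁', hε₁t⟩ : ∃ ε₁ : ℝ, 0 < ε₁ ∧ ε₁ < ε₀ ∧ ENNReal.ofReal ε₁ ≤ t := by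
    have ht1 : min t 1 ≠ ⊤ := by simp
    have hpos : 0 < (min t 1).toReal := ENNReal.toReal_pos (by simp [ht0.ne']) ht1
    refine ⟨min (ε₀ / 2) (min t 1).toReal, by positivity, ?_, ?_⟩
    · exact (min_le_left _ _).trans_lt (by linarith)
    · calc _ ≤ ENNReal.ofReal (min t 1).toReal := ENNReal.ofReal_le_ofReal (min_le_right _ _)
        _ ≤ t := by rw [ENNReal.ofReal_toReal ht1]; exact min_le_left _ _
  obtain ⟨-, hform⟩ := hC ε₁ hε₁ hε₁'
  obtain ⟨τ, hτ0, hτ⟩ := exists_pos_mul_le (K := ENNReal.ofReal (C ε₁) * ℓ)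
    (ENNReal.mul_ne_top (by simp) hℓt) hε2
  obtain ⟨η, hη0, hη⟩ := exists_faberKrahn_small hn hτ0
  have hη4 : 0 < η / 4 := ENNReal.div_pos hη0.ne' (by simp)
  obtain ⟨r, hr, v₀, hv₀s, hv₀c, hv₀1, hv₀E⟩ := exists_small_energy hn hη4
  -- test functions of small energy
  have hsmall : ∀ (e : Set (Euc n)) (u : Euc n → ℝ), ContDiff ℝ (⊤ : ℕ∞) u → HasCompactSupport u →
      MeasurableSet e → (∀ x ∈ e, 1 < u x) → gradSq u + normSq volume u ≤ η / 4 →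
      μ e ≤ ε * (gradSq u + normSq volume u) := by
    intro e u hu hc he hu1 hE
    set v : Euc n → ℝ := fun x => ψ (u x) with hv
    have hvs : ContDiff ℝ (⊤ : ℕ∞) v := hψs.comp hu
    have hvc : HasCompactSupport v := hc.comp_left (g := ψ) (hψ0 0 (by norm_num))
    set D := ∫⁻ x, ‖fderiv ℝ v x‖ₑ ^ 2 with hD
    have hDu : D ≤ ℓ * gradSq u := by
      refine le_trans ?_ (mul_le_mul_right (lintegral_fderiv_sq_le_gradSq u) ℓ)
      rw [← lintegral_const_mul' _ _ hℓt]
      refine lintegral_mono fun x => ?_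
      have hd : HasFDerivAt v (deriv ψ (u x) • fderiv ℝ u x) x :=
        ((hψs.differentiable (by simp)) (u x)).hasDerivAt.comp_hasFDerivAt x
          ((hu.differentiable (by simp)) x).hasFDerivAt
      rw [hd.fderiv, enorm_smul, mul_pow, hℓ]
      gcongr
      rw [Real.enorm_eq_ofReal_abs]
      exact ENNReal.ofReal_le_ofReal (hψL _)
    -- The truncation lives where `u > 1/2`, so Markov's inequality for `u²` at height `1/4` loses a
    -- factor 4; this is why the energy threshold is `η / 4`.
    have hvol : volume {x | v x ≠ 0} ≤ η := by
      have hsub : {x | v x ≠ 0} ⊆ {x | (4 : ℝ≥0∞)⁻¹ ≤ ‖u x‖ₑ ^ 2} := fun x hx => by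
        have h1 : 1 / 2 < u x := by
          by_contra hle; exact hx (hψ0 _ (by linarith))
        have h2 : (2 : ℝ≥0∞)⁻¹ ≤ ‖u x‖ₑ := by
          rw [Real.enorm_eq_ofReal_abs, show (2 : ℝ≥0∞)⁻¹ = ENNReal.ofReal (1 / 2) by
            rw [one_div, ENNReal.ofReal_inv_of_pos (by norm_num)]; simp]
          exact ENNReal.ofReal_le_ofReal (h1.le.trans (le_abs_self _))
        calc (4 : ℝ≥0∞)⁻¹ = (2 : ℝ≥0∞)⁻¹ ^ 2 := by
              rw [← ENNReal.inv_pow]; norm_num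
          _ ≤ _ := by gcongr
      have hmark := meas_ge_le_lintegral_div (μ := volume) (f := fun x => ‖u x‖ₑ ^ 2)
        (((continuous_enorm.comp hu.continuous).measurable).pow_const 2).aemeasurable
        (ε := (4 : ℝ≥0∞)⁻¹) (by simp) (by simp)
      calc _ ≤ _ := measure_mono hsub
        _ ≤ _ := hmark
        _ = 4 * normSq volume u := by rw [ENNReal.div_eq_inv_mul, inv_inv]; rfl
        _ ≤ 4 * (η / 4) := by gcongr; exact le_add_self.trans hE
        _ ≤ η := ENNReal.mul_div_le
    have hFK := hη v (hvs.of_le (by simp)) hvc hvol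
    have hμe : μ e ≤ normSq μ v := by
      rw [← setLIntegral_one e, ← lintegral_indicator he]
      refine lintegral_mono fun x => ?_
      by_cases hx : x ∈ e
      · simp [hx, hv, hψ1 _ (hu1 x hx).le]
      · simp [hx]
    have hf := hform ⟨fun x => (v x : 𝕜), contDiff_ofReal hvs, hasCompactSupport_ofReal hvc, by simp⟩
    simp only [TestFunction.coe_mk, normSq_ofReal] at hf
    calc μ e ≤ _ := hμe
      _ ≤ _ := hf
      _ ≤ t * (n * D) + ENNReal.ofReal (C ε₁) * (τ * D) := by
          gcongr
          exact gradSq_ofReal_le (hvs.differentiable (by simp))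
      _ ≤ t * (n * (ℓ * gradSq u)) + ENNReal.ofReal (C ε₁) * (τ * (ℓ * gradSq u)) := by gcongr
      _ = ((n * ℓ) * t + (ENNReal.ofReal (C ε₁) * ℓ) * τ) * gradSq u := by ring
      _ ≤ (ε / 2 + ε / 2) * (gradSq u + normSq volume u) := by gcongr; exact le_self_add
      _ = _ := by rw [ENNReal.add_halves]
  filter_upwards [Ioc_mem_nhdsGT hr] with δ hδ
  refine iSup₂_le fun e ⟨hec, hed, hecap⟩ => ?_
  rcases e.eq_empty_or_nonempty with rfl | ⟨x₀, hx₀⟩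
  · simp
  by_cases hεt : ε = ⊤
  · rw [hεt]; exact le_top
  have hw : gradSq (fun x => v₀ (x + -x₀)) + normSq volume (fun x => v₀ (x + -x₀)) ≤ η / 4 := by
    refine le_of_eq_of_le ?_ hv₀E
    unfold gradSq normSq
    simp_rw [fderiv_comp_add_right]
    rw [lintegral_add_right_eq_self
      (fun x => ∑ i : Fin n, ‖fderiv ℝ v₀ x (EuclideanSpace.single i (1 : ℝ))‖ₑ ^ 2),
      lintegral_add_right_eq_self (fun x => ‖v₀ x‖ₑ ^ 2)]
  have hμw := hsmall e (fun x => v₀ (x + -x₀)) (hv₀s.comp (by fun_prop))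
    (hv₀c.comp_homeomorph (Homeomorph.addRight (-x₀))) hec.measurableSet (fun x hx => by
      refine hv₀1 _ ?_
      rw [← sub_eq_add_neg, ← dist_eq_norm]
      exact ((Metric.dist_le_diam_of_mem hec.isBounded hx hx₀).trans hed).trans hδ.2) hw
  -- If the energy of the competitor `u` exceeds `η / 4`, it exceeds that of the translated function
  -- from `exists_small_energy`, for which the bound on `μ e` is already known.
  have hall : μ e / ε ≤ cap e := by
    refine le_iInf₂ fun u hu => ENNReal.div_le_of_le_mul' ?_
    rcases le_total (gradSq u + normSq volume u) (η / 4) with hle | hle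
    · exact hsmall e u u.contDiff u.hasCompactSupport hec.measurableSet hu hle
    · exact hμw.trans (mul_le_mul_right (hw.trans hle) ε)
  refine ENNReal.div_le_of_le_mul ?_
  rwa [ENNReal.div_le_iff hε.ne' hεt, mul_comm] at hall

/-! ### Capacitary strong type inequality and the trace condition. -/

/-- Truncations are made on `‖u‖ ^ 2`, which is smooth, while `‖u‖` need not be at the zeros of `u`.
-/
theorem enorm_fderiv_norm_sq_le {u : Euc n → 𝕜} {x : Euc n} (hu : DifferentiableAt ℝ u x) :
    ∃ w' : Euc n →L[ℝ] ℝ, HasFDerivAt (fun x => ‖u x‖ ^ 2) w' x ∧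
      ‖w'‖ ≤ 2 * ‖u x‖ * ‖fderiv ℝ u x‖ := by
  set U := fderiv ℝ u x
  have hre : HasFDerivAt (fun x => RCLike.re (u x)) ((RCLike.reCLM (K := 𝕜)).comp U) x :=
    (RCLike.reCLM (K := 𝕜)).hasFDerivAt.comp x hu.hasFDerivAt
  have him : HasFDerivAt (fun x => RCLike.im (u x)) ((RCLike.imCLM (K := 𝕜)).comp U) x :=
    (RCLike.imCLM (K := 𝕜)).hasFDerivAt.comp x hu.hasFDerivAt
  have h := (hre.fun_mul hre).fun_add (him.fun_mul him)
  simp_rw [← RCLike.norm_sq_eq_def] at h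
  refine ⟨_, h, ContinuousLinearMap.opNorm_le_bound _ (by positivity) fun y => ?_⟩
  have hb : |RCLike.re (u x) * RCLike.re (U y) + RCLike.im (u x) * RCLike.im (U y)| ≤
      ‖u x‖ * ‖U y‖ := by
    refine abs_le_of_sq_le_sq ?_ (by positivity)
    rw [mul_pow, RCLike.norm_sq_eq_def, RCLike.norm_sq_eq_def]
    nlinarith [sq_nonneg (RCLike.re (u x) * RCLike.im (U y) - RCLike.im (u x) * RCLike.re (U y))]
  calc _ = |2 * (RCLike.re (u x) * RCLike.re (U y) + RCLike.im (u x) * RCLike.im (U y))| := by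
        rw [Real.norm_eq_abs]
        congr 1
        simp
        ring
    _ = 2 * |RCLike.re (u x) * RCLike.re (U y) + RCLike.im (u x) * RCLike.im (U y)| := by
        rw [abs_mul, abs_two]
    _ ≤ 2 * (‖u x‖ * (‖U‖ * ‖y‖)) := by
        gcongr
        exact hb.trans (by gcongr; exact U.le_opNorm y)
    _ = _ := by ring

theorem enorm_sq_le_tsum_four_zpow {E : Type*} [NormedAddCommGroup E] (z : E) :
    ‖z‖ₑ ^ 2 ≤ ∑' k : ℤ, 4 * ENNReal.ofReal (4 ^ k) * (if (4 : ℝ) ^ k ≤ ‖z‖ ^ 2 then 1 else 0) := by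
  by_cases hz : z = 0
  · simp [hz]
  obtain ⟨k, hk1, hk2⟩ := exists_mem_Ico_zpow (x := ‖z‖ ^ 2) (y := (4 : ℝ))
    (by positivity) (by norm_num)
  refine le_trans ?_ (ENNReal.le_tsum k)
  rw [if_pos hk1, mul_one, ← ofReal_norm, ← ENNReal.ofReal_pow (norm_nonneg _),
    ← ENNReal.ofReal_ofNat, ← ENNReal.ofReal_mul (by norm_num)]
  refine ENNReal.ofReal_le_ofReal (hk2.le.trans_eq ?_)
  rw [zpow_add₀ (by norm_num), zpow_one, mul_comm]

/-- The bands `[4^k / 2, 4^k]` are pairwise disjoint, because `4^k < 4^(k+1) / 2`. -/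
theorem tsum_four_zpow_band_le (t : ℝ) :
    ∑' k : ℤ, (if (4 : ℝ) ^ k / 2 ≤ t ∧ t ≤ 4 ^ k then (1 : ℝ≥0∞) else 0) ≤ 1 := by
  have key : ∀ k j : ℤ, (4 : ℝ) ^ k / 2 ≤ t → t ≤ 4 ^ j → k ≤ j := fun k j hk hj => by
    by_contra hlt
    have h1 : (4 : ℝ) ^ (j + 1) ≤ 4 ^ k := zpow_le_zpow_right₀ (by norm_num) (by omega)
    rw [zpow_add₀ (by norm_num), zpow_one] at h1
    have h2 : (0 : ℝ) < 4 ^ j := by positivity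
    linarith
  by_cases h : ∃ k : ℤ, (4 : ℝ) ^ k / 2 ≤ t ∧ t ≤ 4 ^ k
  · obtain ⟨k, hk⟩ := h
    rw [tsum_eq_single k fun j hj => if_neg fun hj' =>
      hj (le_antisymm (key _ _ hj'.1 hk.2) (key _ _ hk.1 hj'.2)), if_pos hk]
  · push Not at h
    have : ∀ k : ℤ, (if (4 : ℝ) ^ k / 2 ≤ t ∧ t ≤ 4 ^ k then (1 : ℝ≥0∞) else 0) = 0 := fun k =>
      if_neg fun hk => (h k hk.1).not_ge hk.2
    simp [this]

/-- The capacitary strong type inequality in the form of a trace inequality: if `μ e` is bounded by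
the energy of test functions, then `∫ |u|² dμ` is bounded by the Dirichlet integral. -/
theorem normSq_le_of_measure_le (μ : Measure (Euc n)) (ω : ℝ≥0∞) {Ω : Set (Euc n)}
    (hμ : ∀ e : Set (Euc n), IsCompact e → e ⊆ Ω → ∀ v : Euc n → ℝ, ContDiff ℝ (⊤ : ℕ∞) v →
      HasCompactSupport v → (∀ x ∈ e, 1 < v x) → μ e ≤ ω * (gradSq v + normSq volume v))
    (hFK : ∀ v : Euc n → ℝ, ContDiff ℝ 1 v → HasCompactSupport v → Function.support v ⊆ Ω →
      normSq volume v ≤ ∫⁻ x, ‖fderiv ℝ v x‖ₑ ^ 2)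
    {ψ : ℝ → ℝ} {L : ℝ} (hψs : ContDiff ℝ (⊤ : ℕ∞) ψ)
    (hψ0 : ∀ t ≤ 1 / 2, ψ t = 0) (hψ1 : ∀ t, 1 ≤ t → ψ t = 1) (hψL : ∀ t, |deriv ψ t| ≤ L)
    (hψd : ∀ t, deriv ψ t ≠ 0 → 1 / 2 ≤ t ∧ t ≤ 1)
    {u : Euc n → 𝕜} (hu : ContDiff ℝ (⊤ : ℕ∞) u) (hc : HasCompactSupport u)
    (huΩ : tsupport u ⊆ Ω) :
    normSq μ u ≤ ω * (64 * (n + 1) * ENNReal.ofReal L ^ 2) * gradSq u := by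
  have hL : 0 ≤ L := (abs_nonneg _).trans (hψL 0)
  set w : Euc n → ℝ := fun x => ‖u x‖ ^ 2 with hw
  have hws : ContDiff ℝ (⊤ : ℕ∞) w := hu.norm_sq 𝕜
  -- Equal to 2 on `{w ≥ 4^k}`, hence admissible for the capacity of that level set; its gradient
  -- lives on the band `4^k / 2 ≤ w ≤ 4^k`.
  set v : ℤ → Euc n → ℝ := fun k x => 2 * ψ (((4 : ℝ) ^ k)⁻¹ * w x) with hv
  have hvs : ∀ k, ContDiff ℝ (⊤ : ℕ∞) (v k) := fun k =>
    contDiff_const.mul (hψs.comp (contDiff_const.mul hws))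
  have hvc : ∀ k, HasCompactSupport (v k) := fun k =>
    hc.comp_left (g := fun z : 𝕜 => 2 * ψ (((4 : ℝ) ^ k)⁻¹ * ‖z‖ ^ 2)) (by
      simp [hψ0 0 (by norm_num)])
  have hvsupp : ∀ k, Function.support (v k) ⊆ Ω := fun k x hx => by
    refine huΩ (subset_tsupport u fun h0 => hx ?_)
    simp [hv, hw, h0, hψ0 0 (by norm_num)]
  set A : ℤ → Euc n → ℝ≥0∞ := fun k x =>
    if (4 : ℝ) ^ k / 2 ≤ w x ∧ w x ≤ 4 ^ k then 1 else 0 with hA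
  have hAm : ∀ k, Measurable (A k) := fun k =>
    Measurable.ite (MeasurableSet.inter
      (measurableSet_le measurable_const hws.continuous.measurable)
      (measurableSet_le hws.continuous.measurable measurable_const)) measurable_const
      measurable_const
  have hdm : Measurable fun x => ‖fderiv ℝ u x‖ₑ ^ 2 :=
    ((continuous_enorm.comp (hu.continuous_fderiv (by simp))).measurable).pow_const 2
  -- The chain rule gives `|∇v_k| ≤ 4 L 4^(-k) |u| |∇u|`. Since `|u|² ≤ 4^k` on the band, the weight
  -- `4^k` is exactly compensated.
  have hgrad : ∀ k x, ENNReal.ofReal (4 ^ k) * ‖fderiv ℝ (v k) x‖ₑ ^ 2 ≤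
      16 * ENNReal.ofReal L ^ 2 * (A k x * ‖fderiv ℝ u x‖ₑ ^ 2) := by
    intro k x
    have h4 : (0 : ℝ) < 4 ^ k := by positivity
    obtain ⟨w', hw', hw'n⟩ := enorm_fderiv_norm_sq_le ((hu.differentiable (by simp)) x)
    have hd : HasFDerivAt (v k)
        ((2 : ℝ) • (deriv ψ (((4 : ℝ) ^ k)⁻¹ * w x) • (((4 : ℝ) ^ k)⁻¹ • w'))) x := by
      have h1 : HasFDerivAt (fun x => ((4 : ℝ) ^ k)⁻¹ * w x) (((4 : ℝ) ^ k)⁻¹ • w') x :=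
        hw'.const_mul _
      exact (((hψs.differentiable (by simp)) _).hasDerivAt.comp_hasFDerivAt x h1).const_mul 2
    rw [hd.fderiv]
    by_cases h0 : deriv ψ (((4 : ℝ) ^ k)⁻¹ * w x) = 0
    · rw [h0, zero_smul, smul_zero, ← ofReal_norm, norm_zero]
      simp
    obtain ⟨hlo, hhi⟩ := hψd _ h0
    rw [inv_mul_eq_div, le_div_iff₀ h4] at hlo
    rw [inv_mul_eq_div, div_le_iff₀ h4, one_mul] at hhi
    have hAx : A k x = 1 := if_pos ⟨by linarith, hhi⟩
    rw [hAx, one_mul, ← ofReal_norm, ← ofReal_norm, ← ENNReal.ofReal_pow (norm_nonneg _),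
      ← ENNReal.ofReal_pow (norm_nonneg _), ← ENNReal.ofReal_pow hL,
      show (16 : ℝ≥0∞) = ENNReal.ofReal 16 by simp,
      ← ENNReal.ofReal_mul h4.le, ← ENNReal.ofReal_mul (by norm_num),
      ← ENNReal.ofReal_mul (by positivity)]
    refine ENNReal.ofReal_le_ofReal ?_
    rw [norm_smul, norm_smul, norm_smul, Real.norm_eq_abs (deriv _ _), norm_inv,
      Real.norm_of_nonneg h4.le]
    calc (4 : ℝ) ^ k * (‖(2 : ℝ)‖ * (|deriv ψ (((4 : ℝ) ^ k)⁻¹ * w x)| * (((4 : ℝ) ^ k)⁻¹ * ‖w'‖))) ^ 2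
        ≤ (4 : ℝ) ^ k * (2 * (L * (((4 : ℝ) ^ k)⁻¹ * (2 * ‖u x‖ * ‖fderiv ℝ u x‖)))) ^ 2 := by
          rw [Real.norm_ofNat]
          gcongr
          exact hψL _
      _ = 16 * L ^ 2 * ‖fderiv ℝ u x‖ ^ 2 * (((4 : ℝ) ^ k)⁻¹ * w x) := by
          simp only [hw]; field_simp; ring
      _ ≤ 16 * L ^ 2 * ‖fderiv ℝ u x‖ ^ 2 * 1 := by
          gcongr
          rw [inv_mul_eq_div]; exact div_le_one_of_le₀ hhi h4.le
      _ = _ := mul_one _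
  have hsum : ∑' k : ℤ, ENNReal.ofReal (4 ^ k) * ∫⁻ x, ‖fderiv ℝ (v k) x‖ₑ ^ 2 ≤
      16 * ENNReal.ofReal L ^ 2 * gradSq u := by
    calc _ = ∑' k : ℤ, ∫⁻ x, ENNReal.ofReal (4 ^ k) * ‖fderiv ℝ (v k) x‖ₑ ^ 2 := by
          congr 1; funext k
          rw [lintegral_const_mul' _ _ ENNReal.ofReal_ne_top]
      _ ≤ ∑' k : ℤ, ∫⁻ x, 16 * ENNReal.ofReal L ^ 2 * (A k x * ‖fderiv ℝ u x‖ₑ ^ 2) :=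
          ENNReal.tsum_le_tsum fun k => lintegral_mono (hgrad k)
      _ = 16 * ENNReal.ofReal L ^ 2 * ∫⁻ x, (∑' k : ℤ, A k x) * ‖fderiv ℝ u x‖ₑ ^ 2 := by
          simp_rw [← ENNReal.tsum_mul_right]
          have hm : ∀ k, Measurable fun x => A k x * ‖fderiv ℝ u x‖ₑ ^ 2 := fun k => (hAm k).mul hdm
          rw [lintegral_tsum fun k => (hm k).aemeasurable, ← ENNReal.tsum_mul_left]
          simp_rw [lintegral_const_mul _ (hm _)]
      _ ≤ 16 * ENNReal.ofReal L ^ 2 * ∫⁻ x, 1 * ‖fderiv ℝ u x‖ₑ ^ 2 := by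
          gcongr with x
          exact tsum_four_zpow_band_le (w x)
      _ ≤ _ := by
          simp_rw [one_mul]
          gcongr
          exact lintegral_fderiv_sq_le_gradSq u
  set e : ℤ → Set (Euc n) := fun k => {x | (4 : ℝ) ^ k ≤ w x} with he
  have hesub : ∀ k, e k ⊆ tsupport u := fun k x hx => by
    refine subset_tsupport u fun h0 => ?_
    have h4 : (0 : ℝ) < 4 ^ k := by positivity
    have : (4 : ℝ) ^ k ≤ w x := hx
    simp only [hw, h0, norm_zero] at this
    norm_num at this
    linarith
  have hecl : ∀ k, IsClosed (e k) := fun k => isClosed_le continuous_const hws.continuous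
  -- `n` comes from comparing `gradSq` with the operator norm, and 1 from absorbing the `L²` term by
  -- `hFK`.
  have hμe : ∀ k, μ (e k) ≤ ω * ((n + 1) * ∫⁻ x, ‖fderiv ℝ (v k) x‖ₑ ^ 2) := fun k => by
    refine (hμ (e k) (hc.isCompact.of_isClosed_subset (hecl k) (hesub k)) ((hesub k).trans huΩ)
      (v k) (hvs k) (hvc k) fun x hx => ?_).trans ?_
    · have h4 : (0 : ℝ) < 4 ^ k := by positivity
      have h1 : 1 ≤ ((4 : ℝ) ^ k)⁻¹ * w x := by
        rw [inv_mul_eq_div, one_le_div₀ h4]; exact hx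
      simp only [hv, hψ1 _ h1]; norm_num
    · rw [add_mul, one_mul]
      gcongr
      · exact gradSq_le _
      · exact hFK _ ((hvs k).of_le (by simp)) (hvc k) (hvsupp k)
  calc normSq μ u ≤ ∫⁻ x, ∑' k : ℤ, 4 * ENNReal.ofReal (4 ^ k) *
          (if (4 : ℝ) ^ k ≤ ‖u x‖ ^ 2 then 1 else 0) ∂μ :=
        lintegral_mono fun x => enorm_sq_le_tsum_four_zpow (u x)
    _ = ∑' k : ℤ, 4 * ENNReal.ofReal (4 ^ k) * μ (e k) := by
        have hm : ∀ k : ℤ, Measurable fun x => if (4 : ℝ) ^ k ≤ ‖u x‖ ^ 2 then (1 : ℝ≥0∞) else 0 :=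
          fun k => Measurable.ite (hecl k).measurableSet measurable_const measurable_const
        rw [lintegral_tsum fun k => ((hm k).const_mul _).aemeasurable]
        congr 1; funext k
        rw [lintegral_const_mul _ (hm k), ← lintegral_indicator_one (hecl k).measurableSet]
        rfl
    _ ≤ ∑' k : ℤ, 4 * ENNReal.ofReal (4 ^ k) *
          (ω * ((n + 1) * ∫⁻ x, ‖fderiv ℝ (v k) x‖ₑ ^ 2)) :=
        ENNReal.tsum_le_tsum fun k => mul_le_mul_right (hμe k) _
    _ = 4 * ω * (n + 1) * ∑' k : ℤ, ENNReal.ofReal (4 ^ k) * ∫⁻ x, ‖fderiv ℝ (v k) x‖ₑ ^ 2 := by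
        rw [← ENNReal.tsum_mul_left]
        congr 1; funext k; ring
    _ ≤ 4 * ω * (n + 1) * (16 * ENNReal.ofReal L ^ 2 * gradSq u) := by gcongr
    _ = _ := by ring

theorem tendsto_volume_ball_zero (hn : n ≠ 0) :
    Tendsto (fun δ : ℝ => volume (Metric.ball (0 : Euc n) δ)) (𝓝[>] 0) (𝓝 0) := by
  have h1 : Tendsto (fun δ : ℝ => ENNReal.ofReal (δ ^ n) * volume (Metric.ball (0 : Euc n) 1))
      (𝓝[>] 0) (𝓝 0) := by
    have h2 : Tendsto (fun δ : ℝ => ENNReal.ofReal (δ ^ n)) (𝓝[>] 0) (𝓝 0) := by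
      have : Tendsto (fun δ : ℝ => δ ^ n) (𝓝[>] 0) (𝓝 0) := by
        have h3 : Tendsto (fun δ : ℝ => δ ^ n) (𝓝 0) (𝓝 0) := by
          simpa [hn] using ((continuous_pow n).tendsto (0 : ℝ))
        exact h3.mono_left nhdsWithin_le_nhds
      simpa using ENNReal.tendsto_ofReal this
    simpa using ENNReal.Tendsto.mul_const h2 (Or.inr measure_ball_lt_top.ne)
  refine h1.congr' ?_
  filter_upwards [self_mem_nhdsWithin] with δ hδ
  rw [Measure.addHaar_ball_of_pos volume 0 hδ, finrank_euclideanSpace_fin]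

/-- The capacitary condition on small compact sets implies that the trace constants on small balls
tend to zero. -/
theorem trace_of_capacity (hn : 2 ≤ n) (μ : Measure (Euc n))
    (h : Tendsto (fun δ : ℝ => ⨆ (e : Set (EuclideanSpace ℝ (Fin n)))
          (_ : IsCompact e ∧ Metric.diam e ≤ δ ∧ 0 < cap e), μ e / cap e) (𝓝[>] 0) (𝓝 0)) :
    Tendsto (fun δ : ℝ => ⨆ (x₀ : EuclideanSpace ℝ (Fin n))
          (u : 𝓓(openBall x₀ δ, 𝕜)) (_ : gradSq u ≤ 1), normSq μ u) (𝓝[>] 0) (𝓝 0) := by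
  obtain ⟨ψ, L, hL0, hψs, hψ0, hψ1, hψL, hψd⟩ := exists_smooth_step
  rw [ENNReal.tendsto_nhds_zero] at h ⊢
  intro ε hε
  obtain ⟨ω, hω0, hω⟩ := exists_pos_mul_le (K := 64 * (n + 1) * ENNReal.ofReal L ^ 2)
    (by simp [ENNReal.mul_eq_top]) hε
  obtain ⟨η, hη0, hη⟩ := exists_faberKrahn_small hn one_pos
  obtain ⟨d, hd, hsub⟩ := mem_nhdsGT_iff_exists_Ioc_subset.1 (h ω hω0)
  have hd' : (0 : ℝ) < d := hd
  have hsup := hsub ⟨hd', le_rfl⟩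
  simp only [Set.mem_ofPred_eq, iSup_le_iff] at hsup
  -- Radius at most `d / 2` keeps diameters below `d`; the ball must also be small enough for
  -- Faber–Krahn with constant 1.
  filter_upwards [Ioc_mem_nhdsGT (half_pos hd'),
    (tendsto_volume_ball_zero (n := n) (by omega)).eventually (gt_mem_nhds hη0)] with δ hδ hvol
  refine iSup_le fun x₀ => iSup₂_le fun u hu => ?_
  have hmain := normSq_le_of_measure_le μ ω (Ω := Metric.ball x₀ δ)
    (fun e he heΩ v hv hvc hv1 => measure_le_of_cap hω0.ne'
      (fun e he hed hecap => hsup e ⟨he, hed, hecap⟩) he hδ.1.le (by linarith [hδ.2]) heΩ hv hvc hv1)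
    (fun v hv hvc hvΩ => by
      have := hη v hv hvc ((measure_mono hvΩ).trans (by
        rw [Measure.addHaar_ball_center]; exact hvol.le))
      rwa [one_mul] at this)
    hψs hψ0 hψ1 hψL hψd u.contDiff u.hasCompactSupport u.tsupport_subset
  calc normSq μ u ≤ _ := hmain
    _ ≤ ω * (64 * (n + 1) * ENNReal.ofReal L ^ 2) * 1 := by gcongr
    _ ≤ ε := by rw [mul_one, mul_comm]; exact hω

/-! ### Smooth dyadic potentials and the Carleson condition from the trace condition. -/

theorem enorm_finsetSum_le {ι E : Type*} [SeminormedAddCommGroup E] (s : Finset ι) (f : ι → E) :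
    ‖∑ i ∈ s, f i‖ₑ ≤ ∑ i ∈ s, ‖f i‖ₑ := by
  simp_rw [← ofReal_norm]
  rw [← ENNReal.ofReal_sum_of_nonneg fun i _ => norm_nonneg _]
  exact ENNReal.ofReal_le_ofReal (norm_sum_le _ _)

theorem finite_image_idx {p : ℤ × (Fin n → ℤ)} {k : ℤ} (h : p.1 ≤ k) :
    (idx k '' dyadicCube p).Finite := by
  set N : ℤ := ((2 ^ (k - p.1).toNat : ℕ) : ℤ) with hN
  have hN0 : 0 < N := by positivity
  refine (Set.Finite.pi' fun i => Set.finite_Icc (N * p.2 i) (N * p.2 i + N)).subset ?_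
  rintro _ ⟨x, hx, rfl⟩ i
  have h1 : idx k x i / N = p.2 i := by
    rw [hN, ← idx_eq_ediv h x i, mem_dyadicCube_iff.1 hx]
  have h2 := Int.mul_ediv_add_emod (idx k x i) N
  have h3 := Int.emod_nonneg (idx k x i) hN0.ne'
  have h4 := Int.emod_lt_of_pos (idx k x i) hN0
  rw [h1] at h2
  exact ⟨by linarith, by linarith⟩

theorem abs_idx_sub_le {p : ℤ × (Fin n → ℤ)} {x : Euc n} {r : ℕ}
    (h : ‖(2 : ℝ) ^ p.1 • (x - corner p)‖ < r) (i : Fin n) : |idx p.1 x i - p.2 i| ≤ r := by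
  have h1 := (PiLp.norm_apply_le ((2 : ℝ) ^ p.1 • (x - corner p)) i).trans_lt h
  have h2 : ((2 : ℝ) ^ p.1 • (x - corner p)) i = x i * 2 ^ p.1 - p.2 i := by
    simp only [corner, PiLp.smul_apply, PiLp.sub_apply, smul_eq_mul]
    rw [zpow_neg, mul_sub, mul_comm, mul_comm (p.2 i : ℝ), mul_inv_cancel_left₀ (by positivity)]
  rw [h2, Real.norm_eq_abs, abs_lt] at h1
  have h3 := Int.floor_le (x i * 2 ^ p.1)
  have h4 := Int.lt_floor_add_one (x i * 2 ^ p.1)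
  have h5 : ((idx p.1 x i - p.2 i : ℤ) : ℝ) < r := by
    simp only [idx]; push_cast; linarith
  -- The floor may lose almost 1; strictness still gives `-r` for integers.
  have h6 : (-(r : ℝ) - 1) < ((idx p.1 x i - p.2 i : ℤ) : ℝ) := by
    simp only [idx]; push_cast; linarith
  have h5' : idx p.1 x i - p.2 i < r := by exact_mod_cast h5
  have h6' : -(r : ℤ) - 1 < idx p.1 x i - p.2 i := by exact_mod_cast h6
  rw [abs_le]; omega

theorem sum_measure_dyadicCube_le (ν : Measure (Euc n)) (r : ℕ) (k : ℤ) (S : Finset (Fin n → ℤ))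
    (x : Euc n) (hS : ∀ m ∈ S, ∀ i, |idx k x i - m i| ≤ r) :
    ∑ m ∈ S, ν (dyadicCube (k, m)) ≤ ν (near r k x) := by
  rw [← measure_biUnion_finset _ fun m _ => measurableSet_dyadicCube _]
  · refine measure_mono (Set.iUnion₂_subset fun m hm y hy i => ?_)
    rw [mem_dyadicCube_iff.1 hy, abs_sub_comm]
    exact hS m hm i
  · intro m _ m' _ hmm
    refine Set.disjoint_left.2 fun y hy hy' => hmm ?_
    exact (mem_dyadicCube_iff.1 hy).symm.trans (mem_dyadicCube_iff.1 hy')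

/-- Radius `n` covers the unit cube seen from its corner; the outer radius `n + 2` becomes the index
radius in `near (n + 2)`. -/
theorem exists_bump (n : ℕ) : ∃ b : Euc n → ℝ, ∃ B : ℝ≥0∞, B ≠ ⊤ ∧ ContDiff ℝ (⊤ : ℕ∞) b ∧
    (∀ y, 0 ≤ b y) ∧ (∀ y, ‖y‖ ≤ n → b y = 1) ∧ (∀ y, ‖fderiv ℝ b y‖ₑ ≤ B) ∧
      (∀ y, b y ≠ 0 → ‖y‖ < n + 2) ∧ ∀ y, fderiv ℝ b y ≠ 0 → ‖y‖ < n + 2 := by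
  set b : ContDiffBump (0 : Euc n) := ⟨n + 1, n + 2, by positivity, by linarith⟩ with hb
  have hbs : ContDiff ℝ (⊤ : ℕ∞) b := b.contDiff
  have h0 : ∀ y, b y ≠ 0 → ‖y‖ < n + 2 := fun y hy => by
    by_contra h
    exact hy (b.zero_of_le_dist (x := y) (by simpa [hb] using h))
  obtain ⟨B, hB⟩ := (b.hasCompactSupport.fderiv (𝕜 := ℝ)).exists_bound_of_continuous
    (hbs.continuous_fderiv (by simp))
  refine ⟨b, ENNReal.ofReal B, ENNReal.ofReal_ne_top, hbs, fun y => b.nonneg, fun y hy => ?_,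
    fun y => ?_, h0, fun y hy => ?_⟩
  · refine b.one_of_mem_closedBall ?_
    simp only [hb, mem_closedBall_zero_iff]; linarith
  · rw [← ofReal_norm]; exact ENNReal.ofReal_le_ofReal (hB y)
  · by_contra h
    refine hy (IsLocalMin.fderiv_eq_zero (Eventually.of_forall fun z => ?_))
    rw [b.zero_of_le_dist (x := y) (by simpa [hb] using h)]
    exact b.nonneg

/-- A smooth function at scale `2⁻ᵏ` that dominates the rescaled measures of the dyadic cubes. -/
theorem exists_level_function (n : ℕ) : ∃ B : ℝ≥0∞, B ≠ ⊤ ∧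
    ∀ (ν : Measure (Euc n)) [IsFiniteMeasure ν] (k : ℤ) (S : Finset (Fin n → ℤ)),
      ∃ g : Euc n → ℝ, ContDiff ℝ (⊤ : ℕ∞) g ∧ (∀ x, 0 ≤ g x) ∧
        (∀ x, idx k x ∈ S → 2 ^ (k * ((n : ℤ) - 2)) * ν (near 0 k x) ≤ ENNReal.ofReal (g x)) ∧
        (∀ x, ‖fderiv ℝ g x‖ₑ ≤ B * (2 ^ (k * ((n : ℤ) - 1)) * ν (near (n + 2) k x))) ∧
        ∀ x, g x ≠ 0 → ∃ m ∈ S, dist x (corner (k, m)) ≤ (n + 2) * 2 ^ (-k) := by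
  classical
  obtain ⟨b, B, hB, hbs, hb0, hb1, hbB, hbs0, hbd0⟩ := exists_bump n
  refine ⟨B, hB, fun ν _ k S => ?_⟩
  have h2k : (0 : ℝ) < 2 ^ k := by positivity
  set w : (Fin n → ℤ) → ℝ≥0∞ := fun m => 2 ^ (k * ((n : ℤ) - 2)) * ν (dyadicCube (k, m)) with hw
  have hwt : ∀ m, w m ≠ ⊤ := fun m => ENNReal.mul_ne_top (two_zpow_ne_top _) (measure_ne_top _ _)
  set T : (Fin n → ℤ) → Euc n → Euc n := fun m x => (2 : ℝ) ^ k • (x - corner (k, m)) with hT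
  have hTn : ∀ m x, ‖T m x‖ = 2 ^ k * dist x (corner (k, m)) := fun m x => by
    rw [hT, norm_smul, dist_eq_norm, Real.norm_of_nonneg h2k.le]
  have hder : ∀ x, HasFDerivAt (fun x => ∑ m ∈ S, (w m).toReal * b (T m x))
      (∑ m ∈ S, ((w m).toReal * 2 ^ k) • fderiv ℝ b (T m x)) x := fun x => by
    refine HasFDerivAt.fun_sum fun m _ => ?_
    have h1 : HasFDerivAt (T m) ((2 : ℝ) ^ k • ContinuousLinearMap.id ℝ (Euc n)) x :=
      ((hasFDerivAt_id x).sub_const _).fun_const_smul _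
    have h2 := ((hbs.differentiable (by simp) (T m x)).hasFDerivAt.comp x h1).const_mul (w m).toReal
    refine h2.congr_fderiv ?_
    ext y; simp; ring
  refine ⟨fun x => ∑ m ∈ S, (w m).toReal * b (T m x), ?_, fun x => ?_, fun x hx => ?_, fun x => ?_,
    fun x hx => ?_⟩
  · refine ContDiff.sum fun m _ => contDiff_const.mul (hbs.comp ?_)
    fun_prop
  · exact Finset.sum_nonneg fun m _ => mul_nonneg ENNReal.toReal_nonneg (hb0 _)
  · have h1 : b (T (idx k x) x) = 1 := by
      refine hb1 _ ?_
      rw [hTn]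
      have := dist_le_of_mem_dyadicCube (p := (k, idx k x)) (mem_dyadicCube_iff.2 rfl)
        (corner_mem (k, idx k x))
      calc (2 : ℝ) ^ k * dist x (corner (k, idx k x)) ≤ 2 ^ k * (n * 2 ^ (-k)) := by gcongr
        _ = n := by rw [zpow_neg]; field_simp
    have h2 : (w (idx k x)).toReal ≤ ∑ m ∈ S, (w m).toReal * b (T m x) := by
      have := Finset.single_le_sum (f := fun m => (w m).toReal * b (T m x))
        (fun m _ => mul_nonneg ENNReal.toReal_nonneg (hb0 _)) hx
      simpa [h1] using this
    rw [near_zero_eq]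
    have h3 := ENNReal.ofReal_le_ofReal h2
    rwa [ENNReal.ofReal_toReal (hwt _)] at h3
  · rw [(hder x).fderiv]
    -- Only the bumps of nearby cubes have a gradient at `x`. The factor `2 ^ k` of the chain rule
    -- turns the weight exponent `n - 2` into `n - 1`.
    set S' := S.filter fun m => ∀ i, |idx k x i - m i| ≤ ((n + 2 : ℕ) : ℤ) with hS'
    calc ‖∑ m ∈ S, ((w m).toReal * 2 ^ k) • fderiv ℝ b (T m x)‖ₑ
        ≤ ∑ m ∈ S, ‖((w m).toReal * 2 ^ k) • fderiv ℝ b (T m x)‖ₑ := enorm_finsetSum_le _ _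
      _ = ∑ m ∈ S', ‖((w m).toReal * 2 ^ k) • fderiv ℝ b (T m x)‖ₑ := by
          refine (Finset.sum_filter_of_ne fun m _ hm => ?_).symm
          have h1 : fderiv ℝ b (T m x) ≠ 0 := fun h => by
            rw [h, smul_zero, ← ofReal_norm, norm_zero, ENNReal.ofReal_zero] at hm
            exact hm rfl
          have h2 : ‖T m x‖ < ((n + 2 : ℕ) : ℝ) := by push_cast; exact hbd0 _ h1
          exact abs_idx_sub_le (p := (k, m)) h2
      _ ≤ ∑ m ∈ S', B * (2 ^ (k * ((n : ℤ) - 1)) * ν (dyadicCube (k, m))) := by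
          refine Finset.sum_le_sum fun m _ => ?_
          rw [enorm_smul, enorm_mul, Real.enorm_of_nonneg ENNReal.toReal_nonneg,
            ENNReal.ofReal_toReal (hwt m), Real.enorm_of_nonneg h2k.le, ofReal_two_zpow, mul_comm]
          refine mul_le_mul' (hbB _) (le_of_eq ?_)
          rw [hw, show k * ((n : ℤ) - 1) = k * ((n : ℤ) - 2) + k by ring, two_zpow_add]
          ring
      _ = B * (2 ^ (k * ((n : ℤ) - 1)) * ∑ m ∈ S', ν (dyadicCube (k, m))) := by
          rw [Finset.mul_sum, Finset.mul_sum]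
      _ ≤ _ := by
          gcongr
          exact sum_measure_dyadicCube_le ν _ k S' x fun m hm => (Finset.mem_filter.1 hm).2
  · obtain ⟨m, hm, hne⟩ := Finset.exists_ne_zero_of_sum_ne_zero hx
    refine ⟨m, hm, ?_⟩
    have := hbs0 _ (right_ne_zero_of_mul hne)
    rw [hTn] at this
    rw [zpow_neg, ← div_eq_mul_inv, le_div_iff₀ h2k, mul_comm]
    exact this.le

/-- A trace inequality for normalized test functions extends by scaling. -/
theorem normSq_le_of_gradient_le {μ : Measure (Euc n)} {Ω : Opens (Euc n)} {ω G : ℝ≥0∞}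
    (h : ∀ u : 𝓓(Ω, 𝕜), gradSq u ≤ 1 → normSq μ u ≤ ω) (hG0 : G ≠ 0) (hG : G ≠ ⊤)
    {v : Euc n → ℝ} (hv : ContDiff ℝ (⊤ : ℕ∞) v) (hc : HasCompactSupport v) (hΩ : tsupport v ⊆ Ω)
    (hvG : n * ∫⁻ x, ‖fderiv ℝ v x‖ₑ ^ 2 ≤ G) : normSq μ v ≤ G * ω := by
  have ht : 0 < G.toReal := ENNReal.toReal_pos hG0 hG
  set s : ℝ := (√G.toReal)⁻¹ with hs
  have hs2 : ‖s‖ₑ ^ 2 = G⁻¹ := by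
    rw [Real.enorm_of_nonneg (by positivity), ← ENNReal.ofReal_pow (by positivity), hs, inv_pow,
      Real.sq_sqrt ht.le, ENNReal.ofReal_inv_of_pos ht, ENNReal.ofReal_toReal hG]
  set w : Euc n → ℝ := fun x => s * v x with hw
  have hws : ContDiff ℝ (⊤ : ℕ∞) w := contDiff_const.mul hv
  have hwc : HasCompactSupport w := hc.mul_left
  have hsupp : tsupport (fun x => (w x : 𝕜)) ⊆ Ω := by
    refine (closure_mono fun x hx => ?_).trans hΩ
    intro h0
    exact hx (by simp [hw, h0])
  have hgw : ∫⁻ x, ‖fderiv ℝ w x‖ₑ ^ 2 = G⁻¹ * ∫⁻ x, ‖fderiv ℝ v x‖ₑ ^ 2 := by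
    rw [← lintegral_const_mul' _ _ (by simp [hG0])]
    refine lintegral_congr fun x => ?_
    rw [((hv.differentiable (by simp) x).hasFDerivAt.const_mul s).fderiv, enorm_smul, mul_pow, hs2]
  have h1 := h ⟨fun x => (w x : 𝕜), contDiff_ofReal hws, hasCompactSupport_ofReal hwc, hsupp⟩ <| by
    refine (gradSq_ofReal_le (hws.differentiable (by simp))).trans ?_
    rw [hgw, mul_left_comm]
    exact (mul_le_mul_right hvG _).trans (ENNReal.inv_mul_le_one G)
  have h2 : normSq μ w = G⁻¹ * normSq μ v := by
    rw [normSq, normSq, ← lintegral_const_mul' _ _ (by simp [hG0])]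
    refine lintegral_congr fun x => ?_
    rw [hw, enorm_mul, mul_pow, hs2]
  have h3 : G⁻¹ * normSq μ v ≤ ω := by
    rw [← h2, ← normSq_ofReal (𝕜 := 𝕜)]; exact h1
  calc normSq μ v = G * (G⁻¹ * normSq μ v) := by
        rw [← mul_assoc, ENNReal.mul_inv_cancel hG0 hG, one_mul]
    _ ≤ _ := by gcongr

/-- For every dyadic cube and every truncation of its Carleson sum there is a test function that
dominates the corresponding dyadic potential and whose Dirichlet integral is controlled by the
truncated sum. -/
theorem exists_dyadic_potential (n : ℕ) : ∃ M : ℝ≥0∞, M ≠ ⊤ ∧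
    ∀ (μ : Measure (Euc n)) [IsLocallyFiniteMeasure μ] (p : ℤ × (Fin n → ℤ)) (K : ℕ),
      ∃ u : Euc n → ℝ, ContDiff ℝ (⊤ : ℕ∞) u ∧
        tsupport u ⊆ Metric.closedBall (corner p) ((2 * n + 2) * 2 ^ (-p.1)) ∧
        (∀ x ∈ dyadicCube p, ∑ j ∈ Finset.range K, 2 ^ ((p.1 + j) * ((n : ℤ) - 2)) *
          μ.restrict (dyadicCube p) (near 0 (p.1 + j) x) ≤ ‖u x‖ₑ) ∧
        ∫⁻ x, ‖fderiv ℝ u x‖ₑ ^ 2 ≤ M * ∑ j ∈ Finset.range K, 2 ^ ((p.1 + j) * ((n : ℤ) - 2)) *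
          ∫⁻ y, μ.restrict (dyadicCube p) (near 0 (p.1 + j) y) ∂(μ.restrict (dyadicCube p)) := by
  obtain ⟨B, hB, hlev⟩ := exists_level_function n
  refine ⟨B ^ 2 * (4 * (2 * (n + 2 : ℕ) + 1) ^ n * (2 * (2 * (2 * (n + 2) : ℕ) + 1) ^ n)), ?_,
    fun μ _ p K => ?_⟩
  · exact ENNReal.mul_ne_top (ENNReal.pow_ne_top hB) (by norm_cast; exact ENNReal.natCast_ne_top _)
  set ν := μ.restrict (dyadicCube p) with hν
  have : IsFiniteMeasure ν := isFiniteMeasure_restrict.2 (measure_dyadicCube_ne_top μ p)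
  have hle : ∀ j : ℕ, p.1 ≤ p.1 + j := fun j => by omega
  choose g hgs hg0 hglow hgd hgsupp using fun j : ℕ =>
    hlev ν (p.1 + j) (finite_image_idx (hle j)).toFinset
  set u : Euc n → ℝ := fun x => ∑ j ∈ Finset.range K, g j x with hu
  -- The truncation keeps `u` a finite sum of smooth functions while the energy estimate for series
  -- applies.
  set θ : ℕ → ℝ≥0∞ := fun j => if j < K then 1 else 0 with hθ
  have hsum : ∀ a : ℕ → ℝ≥0∞, ∑' j, θ j * a j = ∑ j ∈ Finset.range K, a j := fun a => by
    rw [tsum_eq_sum (s := Finset.range K)]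
    · refine Finset.sum_congr rfl fun j hj => ?_
      simp [hθ, Finset.mem_range.1 hj]
    · intro j hj
      simp [hθ, Finset.mem_range.not.1 hj]
  refine ⟨u, ContDiff.sum fun j _ => hgs j, ?_, fun x hx => ?_, ?_⟩
  · refine closure_minimal (fun x hx => ?_) Metric.isClosed_closedBall
    obtain ⟨j, -, hj⟩ := Finset.exists_ne_zero_of_sum_ne_zero hx
    obtain ⟨m, hm, hd⟩ := hgsupp j x hj
    obtain ⟨y, hy, rfl⟩ := (finite_image_idx (hle j)).mem_toFinset.1 hm
    have h1 : corner (p.1 + j, idx (p.1 + j) y) ∈ dyadicCube p :=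
      dyadicCube_subset_of_mem (q := (p.1 + j, idx (p.1 + j) y)) (hle j) hy
        (mem_dyadicCube_iff.2 rfl) (corner_mem _)
    have h2 := dist_le_of_mem_dyadicCube h1 (corner_mem p)
    have h3 : (2 : ℝ) ^ (-(p.1 + j)) ≤ 2 ^ (-p.1) :=
      zpow_le_zpow_right₀ (by norm_num) (by omega)
    rw [Metric.mem_closedBall]
    calc dist x (corner p) ≤ _ := dist_triangle _ _ _
      _ ≤ (n + 2) * 2 ^ (-(p.1 + j)) + n * 2 ^ (-p.1) := add_le_add hd h2
      _ ≤ (n + 2) * 2 ^ (-p.1) + n * 2 ^ (-p.1) := by gcongr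
      _ = _ := by ring
  · rw [Real.enorm_of_nonneg (Finset.sum_nonneg fun j _ => hg0 j x),
      ENNReal.ofReal_sum_of_nonneg fun j _ => hg0 j x]
    exact Finset.sum_le_sum fun j _ => hglow j x
      ((finite_image_idx (hle j)).mem_toFinset.2 ⟨x, hx, rfl⟩)
  · have hder : ∀ x, ‖fderiv ℝ u x‖ₑ ≤ B * ∑' j : ℕ, θ j *
        (2 ^ ((p.1 + j) * ((n : ℤ) - 1)) * ν (near (n + 2) (p.1 + j) x)) := fun x => by
      rw [hsum, hu, fderiv_fun_sum fun j _ => (hgs j).differentiable (by simp) x, Finset.mul_sum]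
      exact (enorm_finsetSum_le _ _).trans (Finset.sum_le_sum fun j _ => hgd j x)
    rw [← hsum]
    calc ∫⁻ x, ‖fderiv ℝ u x‖ₑ ^ 2
        ≤ ∫⁻ x, B ^ 2 * (∑' j : ℕ, θ j *
          (2 ^ ((p.1 + j) * ((n : ℤ) - 1)) * ν (near (n + 2) (p.1 + j) x))) ^ 2 :=
          lintegral_mono fun x => by rw [← mul_pow]; exact pow_le_pow_left' (hder x) 2
      _ = B ^ 2 * ∫⁻ x, (∑' j : ℕ, θ j *
          (2 ^ ((p.1 + j) * ((n : ℤ) - 1)) * ν (near (n + 2) (p.1 + j) x))) ^ 2 :=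
          lintegral_const_mul' _ _ (ENNReal.pow_ne_top hB)
      _ ≤ B ^ 2 * (4 * (2 * (n + 2 : ℕ) + 1) ^ n * ∑' j : ℕ, θ j *
          (2 ^ ((p.1 + j) * ((n : ℤ) - 2)) *
            ∫⁻ y, ν (near (2 * (n + 2)) (p.1 + j) y) ∂ν)) := by
          refine mul_le_mul_right (lintegral_sq_tsum_measure_near_le ν (n + 2) p.1 θ fun j => ?_) _
          simp only [hθ]; split_ifs <;> simp
      _ ≤ B ^ 2 * (4 * (2 * (n + 2 : ℕ) + 1) ^ n * ∑' j : ℕ,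
          (2 * (2 * (2 * (n + 2) : ℕ) + 1) ^ n) * (θ j * (2 ^ ((p.1 + j) * ((n : ℤ) - 2)) *
            ∫⁻ y, ν (near 0 (p.1 + j) y) ∂ν))) := by
          refine mul_le_mul_right (mul_le_mul_right (ENNReal.tsum_le_tsum fun j => ?_) _) _
          calc _ ≤ θ j * (2 ^ ((p.1 + j) * ((n : ℤ) - 2)) *
                ((2 * (2 * (2 * (n + 2) : ℕ) + 1) ^ n) * ∫⁻ y, ν (near 0 (p.1 + j) y) ∂ν)) :=
                mul_le_mul_right (mul_le_mul_right (lintegral_measure_near_le ν _ _) _) _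
            _ = _ := by ring
      _ = _ := by rw [ENNReal.tsum_mul_left]; ring

/-- A trace inequality near a dyadic cube bounds its Carleson sum. -/
theorem exists_carlesonSum_le (𝕜 : Type*) [RCLike 𝕜] (hn : n ≠ 0) : ∃ M : ℝ≥0∞, M ≠ ⊤ ∧
    ∀ (μ : Measure (Euc n)) [IsLocallyFiniteMeasure μ] (p : ℤ × (Fin n → ℤ)) (δ : ℝ) (ω : ℝ≥0∞),
      (2 * n + 2) * 2 ^ (-p.1) < δ →
      (∀ u : 𝓓(openBall (corner p) δ, 𝕜), gradSq u ≤ 1 → normSq μ u ≤ ω) →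
        carlesonSum μ p ≤ M * ω * μ (dyadicCube p) := by
  obtain ⟨M, hM, hpot⟩ := exists_dyadic_potential n
  -- The `+ 1` makes the bound used for normalization nonzero even if `M = 0`.
  refine ⟨n * M + 1, by simp [ENNReal.mul_eq_top, hM], fun μ _ p δ ω hδ htr => ?_⟩
  rw [carlesonSum, tsum_level_sq hn]
  refine ENNReal.tsum_le_of_sum_range_le fun K => ?_
  obtain ⟨u, hus, husupp, hulow, hugrad⟩ := hpot μ p K
  set ν := μ.restrict (dyadicCube p) with hν
  have : IsFiniteMeasure ν := isFiniteMeasure_restrict.2 (measure_dyadicCube_ne_top μ p)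
  set T := ∑ j ∈ Finset.range K, (2 : ℝ≥0∞) ^ ((p.1 + j) * ((n : ℤ) - 2)) *
    ∫⁻ y, ν (near 0 (p.1 + j) y) ∂ν with hT
  have hTt : T ≠ ⊤ := ENNReal.sum_ne_top.2 fun j _ => by
    refine ENNReal.mul_ne_top (two_zpow_ne_top _) (ne_top_of_le_ne_top ?_
      (lintegral_mono fun y => measure_mono (Set.subset_univ _)))
    rw [lintegral_const]
    exact ENNReal.mul_ne_top (measure_ne_top _ _) (measure_ne_top _ _)
  rcases eq_or_ne T 0 with hT0 | hT0
  · rw [hT0]; exact zero_le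
  have hc : HasCompactSupport u :=
    (isCompact_closedBall _ _).of_isClosed_subset (isClosed_tsupport u) husupp
  have hnorm : normSq μ u ≤ (n * M + 1) * T * ω := by
    refine normSq_le_of_gradient_le htr (mul_ne_zero (by simp) hT0)
      (ENNReal.mul_ne_top (by simp [ENNReal.mul_eq_top, hM]) hTt) hus hc
      (husupp.trans (Metric.closedBall_subset_ball hδ)) ?_
    calc _ ≤ n * (M * T) := mul_le_mul_right hugrad _
      _ ≤ _ := by rw [add_mul, one_mul, mul_assoc]; exact le_self_add
  -- The truncated sum is the `ν`-integral of the dyadic potential that `u` dominates. With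
  -- Cauchy–Schwarz and `hnorm` its square is bounded by a multiple of `T`, and `T` is finite, so it
  -- cancels.
  have hTu : T ≤ ∫⁻ x, 1 * ‖u x‖ₑ ∂ν := by
    have hm : ∀ j : ℕ, Measurable fun y => (2 : ℝ≥0∞) ^ ((p.1 + j) * ((n : ℤ) - 2)) *
      ν (near 0 (p.1 + j) y) := fun j => (measurable_measure_near ν 0 _).const_mul _
    calc T = ∫⁻ x, ∑ j ∈ Finset.range K, (2 : ℝ≥0∞) ^ ((p.1 + j) * ((n : ℤ) - 2)) *
          ν (near 0 (p.1 + j) x) ∂ν := by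
          rw [lintegral_finsetSum _ fun j _ => hm j]
          refine Finset.sum_congr rfl fun j _ => ?_
          rw [lintegral_const_mul' _ _ (two_zpow_ne_top _)]
      _ ≤ _ := by
          refine lintegral_mono_ae ?_
          filter_upwards [ae_restrict_mem (measurableSet_dyadicCube p)] with x hx
          rw [one_mul]; exact hulow x hx
  have hsq : T * T ≤ ((n * M + 1) * ω * μ (dyadicCube p)) * T := by
    calc T * T = T ^ 2 := (sq T).symm
      _ ≤ (∫⁻ x, 1 * ‖u x‖ₑ ∂ν) ^ 2 := pow_le_pow_left' hTu 2
      _ ≤ (∫⁻ _, 1 ^ 2 ∂ν) * ∫⁻ x, ‖u x‖ₑ ^ 2 ∂ν :=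
          lintegral_mul_sq_le ν aemeasurable_const hus.continuous.enorm.measurable.aemeasurable
      _ ≤ μ (dyadicCube p) * ((n * M + 1) * T * ω) := by
          refine mul_le_mul' (by simp [hν]) (le_trans ?_ hnorm)
          exact lintegral_mono' Measure.restrict_le_self le_rfl
      _ = _ := by ring
  exact (ENNReal.mul_le_mul_iff_left hT0 hTt).1 hsq

/-- Vanishing of the trace constants on small balls implies the dyadic Carleson condition. -/
theorem carleson_of_trace (hn : n ≠ 0) (μ : Measure (Euc n)) [IsLocallyFiniteMeasure μ]
    (h : Tendsto (fun δ : ℝ => ⨆ (x₀ : EuclideanSpace ℝ (Fin n))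
          (u : 𝓓(openBall x₀ δ, 𝕜)) (_ : gradSq u ≤ 1), normSq μ u) (𝓝[>] 0) (𝓝 0)) :
    Tendsto (fun δ : ℝ => ⨆ (p₀ : ℤ × (Fin n → ℤ))
          (_ : Metric.diam (dyadicCube p₀) ≤ δ ∧ μ (dyadicCube p₀) ≠ 0),
            carlesonSum μ p₀ / μ (dyadicCube p₀)) (𝓝[>] 0) (𝓝 0) := by
  obtain ⟨M, hM, hcar⟩ := exists_carlesonSum_le (n := n) 𝕜 hn
  rw [ENNReal.tendsto_nhds_zero] at h ⊢
  intro ε hε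
  obtain ⟨ω, hω0, hω⟩ := exists_pos_mul_le hM hε
  obtain ⟨d, hd, hsub⟩ := mem_nhdsGT_iff_exists_Ioc_subset.1 (h ω hω0)
  have hd' : (0 : ℝ) < d := hd
  have hsup := hsub ⟨hd', le_rfl⟩
  simp only [Set.mem_ofPred_eq, iSup_le_iff] at hsup
  -- The side is at most twice the diameter, so the radius `(2n+2) 2^(-k)` around the corner is at
  -- most `(4n+4) δ < d`.
  have hpos : 0 < d / (4 * n + 5) := by positivity
  filter_upwards [Ioc_mem_nhdsGT hpos] with δ hδ
  refine iSup₂_le fun p hp => ?_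
  refine (ENNReal.div_le_of_le_mul ?_)
  have hside := (half_side_le_diam hn p).trans (hp.1.trans hδ.2)
  have h0 : (0 : ℝ) < 2 ^ (-p.1) := by positivity
  have hlt : (2 * n + 2) * (2 : ℝ) ^ (-p.1) < d := by
    rw [le_div_iff₀ (by positivity)] at hside
    nlinarith
  exact (hcar μ p d ω hlt (hsup (corner p))).trans (mul_le_mul_left hω _)

end FormBound

theorem theorem4p1 {𝕜 : Type*} [RCLike 𝕜] {n : ℕ} (hn : 2 ≤ n)
    (μ : Measure (EuclideanSpace ℝ (Fin n))) [IsLocallyFiniteMeasure μ] :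
    List.TFAE [
      -- infinitesimal form boundedness
      ∃ ε₀ : ℝ, 0 < ε₀ ∧ ∃ C : ℝ → ℝ, ∀ ε : ℝ, 0 < ε → ε < ε₀ → 0 < C ε ∧
        ∀ u : 𝓓((⊤ : Opens (EuclideanSpace ℝ (Fin n))), 𝕜),
          FormBound.normSq μ u ≤ ENNReal.ofReal ε * FormBound.gradSq u +
            ENNReal.ofReal (C ε) * FormBound.normSq volume u,
      -- local trace constants on small balls
      Tendsto (fun δ : ℝ => ⨆ (x₀ : EuclideanSpace ℝ (Fin n))
          (u : 𝓓(FormBound.openBall x₀ δ, 𝕜)) (_ : FormBound.gradSq u ≤ 1),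
            FormBound.normSq μ u) (𝓝[>] 0) (𝓝 0),
      -- small compact sets of positive capacity
      Tendsto (fun δ : ℝ => ⨆ (e : Set (EuclideanSpace ℝ (Fin n)))
          (_ : IsCompact e ∧ Metric.diam e ≤ δ ∧ 0 < FormBound.cap e),
            μ e / FormBound.cap e) (𝓝[>] 0) (𝓝 0),
      -- dyadic Carleson sums over small dyadic cubes
      Tendsto (fun δ : ℝ => ⨆ (p₀ : ℤ × (Fin n → ℤ))
          (_ : Metric.diam (FormBound.dyadicCube p₀) ≤ δ ∧ μ (FormBound.dyadicCube p₀) ≠ 0),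
            FormBound.carlesonSum μ p₀ / μ (FormBound.dyadicCube p₀)) (𝓝[>] 0) (𝓝 0)] := by
  have hn0 : n ≠ 0 := by omega
  tfae_have 1 → 3 := FormBound.capacity_of_formBound hn μ
  tfae_have 3 → 2 := FormBound.trace_of_capacity hn μ
  tfae_have 2 → 4 := FormBound.carleson_of_trace hn0 μ
  tfae_have 4 → 1 := FormBound.formBound_of_carleson hn0 μ
  tfae_finish
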